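/- Let $d\ge 1$ be an integer, let $s\in(0,1)$, and let $|x-y|$ denote the graph distance on the lattice graph $\mathbb{Z}^d$ (vertices $x,y$ are adjacent iff $\sum_{i=1}^d|x_i-y_i|=1$). Let $w_s(x,y)$, $x\ne y$, be symmetric and positive, with constants $c,C>0$ such that $c\,|x-y|^{-d-2s}\le w_s(x,y)\le C\,|x-y|^{-d-2s}$ for all $x\neq y$. Set $(-\Delta)^su(x)=\sum_{y\ne x}w_s(x,y)(u(x)-u(y))$ for $u\in\ell^\infty(\mathbb Z^d)$, $\nabla^su\nabla^sv(x)=\frac12\sum_{y\neq x}w_s(x,y)(u(x)-u(y))(v(x)-v(y))$ and $|\nabla^su|^2=\nabla^su\nabla^su$. Let $h:\mathbb{Z}^d\to\mathbb{R}$ satisfy $(h_1)$ there is $h_0\in(-1,0)$ with $\inf_{x\in\mathbb Z^d} h(x)\ge h_0$; $(h_3)$ $h(x)\to+\infty$ as $|x-x_0|\to+\infty$, for some $x_0\in\mathbb{Z}^d$. Let $\mathcal H_s$ be the set of $u\in\ell^\infty(\mathbb{Z}^d)$ with $\sum_x(|\nabla^su|^2+u^2)<\infty$ and $\sum_x(h+1)u^2<\infty$,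 and let $D(J)=\{u\in\mathcal H_s:\sum_xu^2|\log u^2|<\infty\}$ (with $0\log 0=0$). For $u,\phi\in D(J)$ put $$J(u)=\tfrac12\sum_x\big(|\nabla^su|^2+(h+1)u^2\big)-\tfrac12\sum_xu^2\log u^2,$$ $$\langle J'(u),\phi\rangle=\sum_x\big(\nabla^su\nabla^s\phi+h\,u\phi\big)-\sum_xu\phi\log u^2 .$$ With $u^+=\max\{u,0\}$ and $u^-=\min\{u,0\}$ let $$\mathcal M=\{u\in D(J):u^+\neq0,\ u^-\ne0,\ \langle J'(u),u^+\rangle=\langle J'(u),u^-\rangle=0\},\qquad m=\inf_{u\in\mathcal M}J(u).$$ Then the equation $$(-\Delta)^su+h(x)u=u\log u^2\quad\text{on }\mathbb{Z}^d$$ has a ground state sign-changing solution: there is $u\in\mathcal M$ such that $\langle J'(u),\phi\rangle=0$ for all $\phi\in D(J)$ (that is, $u$ is a weak solution), $u$ satisfies the equation at every point of $\mathbb Z^d$, and $J(u)=m>0$. -/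

import Mathlib

open Filter

noncomputable section

namespace FracLog

/-- The vertex set of the `d`-dimensional integer lattice. -/
abbrev Lattice (d : ℕ) : Type := Fin d → ℤ

/-- The integer lattice graph: `x` and `y` are neighbours iff `∑ i, |x i - y i| = 1`. -/
def latticeGraph (d : ℕ) : SimpleGraph (Lattice d) where
  Adj x y := ∑ i, |x i - y i| = 1
  symm := ⟨fun x y h => by simpa only [abs_sub_comm] using h⟩
  loopless := ⟨fun x h => by simp at h⟩

/-- The distance `|x - y|`: the number of edges of a shortest path from `x` to `y`. -/
def latDist {d : ℕ} (x y : Lattice d) : ℝ := ((latticeGraph d).dist x y : ℝ)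

/-- The weights `w_s(x, y)`, `x ≠ y`, of the fractional Laplacian of order `s`: symmetric, positive,
and comparable to `|x - y| ^ (-d - 2 s)`. Values on the diagonal play no role. -/
structure IsFracKernel {d : ℕ} (s : ℝ) (w : Lattice d → Lattice d → ℝ) : Prop where
  symm : ∀ x y, x ≠ y → w x y = w y x
  pos : ∀ x y, x ≠ y → 0 < w x y
  bounds : ∃ c C : ℝ, 0 < c ∧ 0 < C ∧ ∀ x y, x ≠ y →
    c * latDist x y ^ (-(d : ℝ) - 2 * s) ≤ w x y ∧
      w x y ≤ C * latDist x y ^ (-(d : ℝ) - 2 * s)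

/-- The potential has a lower bound `h₀ ∈ (-1, 0)`. -/
def PotentialBelow {d : ℕ} (h : Lattice d → ℝ) : Prop :=
  ∃ h₀ : ℝ, -1 < h₀ ∧ h₀ < 0 ∧ ∀ x, h₀ ≤ h x

/-- Coercivity: `h x → +∞` as `|x - x₀| → +∞`, for some vertex `x₀`. -/
def PotentialCoercive {d : ℕ} (h : Lattice d → ℝ) : Prop :=
  ∃ x₀ : Lattice d, Tendsto h (comap (fun x => latDist x x₀) atTop) atTop

variable {d : ℕ} (w : Lattice d → Lattice d → ℝ) (h : Lattice d → ℝ)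

/-- The fractional Laplacian `(-Δ)^s u (x) = ∑_{y ≠ x} w x y (u x - u y)`. -/
def fracLaplacian (u : Lattice d → ℝ) (x : Lattice d) : ℝ :=
  ∑' y : {y : Lattice d // y ≠ x}, w x y * (u x - u y)

/-- The fractional gradient form `∇^s u ∇^s v (x)`. -/
def gradForm (u v : Lattice d → ℝ) (x : Lattice d) : ℝ :=
  (1 / 2) * ∑' y : {y : Lattice d // y ≠ x}, w x y * ((u x - u y) * (v x - v y))

/-- The space `W^{s,2}`: bounded functions with `∑_x (|∇^s u|² + u²) < ∞`. The field `grad_inner`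
says that every `|∇^s u| (x)` is finite. -/
structure MemW (u : Lattice d → ℝ) : Prop where
  bounded : ∃ B : ℝ, ∀ x, |u x| ≤ B
  grad_inner : ∀ x, Summable fun y : {y : Lattice d // y ≠ x} => w x y * ((u x - u y) * (u x - u y))
  energy : Summable fun x => gradForm w u u x + u x ^ 2

/-- The space `H_s`. -/
structure MemH (u : Lattice d → ℝ) : Prop where
  memW : MemW w u
  potential : Summable fun x => (h x + 1) * u x ^ 2

/-- The effective domain `D(J)`: `u ∈ H_s` with `∑_x u² |log u²| < ∞`
(here `0 * |log 0| = 0`, as usual). -/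
def domJ : Set (Lattice d → ℝ) :=
  {u | MemH w h u ∧ Summable fun x => u x ^ 2 * |Real.log (u x ^ 2)|}

/-- The energy functional `J` (used on `D(J)`, where both series converge absolutely). -/
def energyJ (u : Lattice d → ℝ) : ℝ :=
  (1 / 2) * ∑' x, (gradForm w u u x + (h x + 1) * u x ^ 2)
    - (1 / 2) * ∑' x, u x ^ 2 * Real.log (u x ^ 2)

/-- The pairing `⟨J'(u), φ⟩` (used for `u, φ ∈ D(J)`, where both series converge absolutely). -/
def derivJ (u φ : Lattice d → ℝ) : ℝ :=
  ∑' x, (gradForm w u φ x + h x * (u x * φ x)) - ∑' x, u x * φ x * Real.log (u x ^ 2)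

/-- Weak solutions of `(-Δ)^s u + h u = u log u²`: critical points of `J` in `D(J)`. -/
def IsWeakSolution (u : Lattice d → ℝ) : Prop :=
  u ∈ domJ w h ∧ ∀ φ ∈ domJ w h, derivJ w h u φ = 0

/-- Pointwise solutions of `(-Δ)^s u + h u = u log u²`, with convergence of the series
that defines `(-Δ)^s u (x)`. -/
def IsPointwiseSolution (u : Lattice d → ℝ) : Prop :=
  ∀ x, (Summable fun y : {y : Lattice d // y ≠ x} => w x y * (u x - u y)) ∧
    fracLaplacian w u x + h x * u x = u x * Real.log (u x ^ 2)

/-- `u⁺ = max {u, 0}`. -/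
def uPlus (u : Lattice d → ℝ) : Lattice d → ℝ := fun x => max (u x) 0

/-- `u⁻ = min {u, 0}`. -/
def uMinus (u : Lattice d → ℝ) : Lattice d → ℝ := fun x => min (u x) 0

/-- The sign-changing Nehari set `M`. -/
def nehariSC : Set (Lattice d → ℝ) :=
  {u | u ∈ domJ w h ∧ uPlus u ≠ 0 ∧ uMinus u ≠ 0 ∧
    derivJ w h u (uPlus u) = 0 ∧ derivJ w h u (uMinus u) = 0}

/-- The level `m = inf_M J`. -/
def levelSC : ℝ := sInf (energyJ w h '' nehariSC w h)

end FracLog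

end

/-! The row sums of the kernel are bounded, so the Dirichlet form is finite on `ℓ²`, and `D(J)` is
described by convergence of the three local series in `LogDomain`. Write `u = p + q` with `p = u⁺`,
`q = u⁻`, and put `A = nehariForm p`, `B = nehariForm q`, `K = energyForm p q`, `P = sqSum p`, `N =
sqSum q`. The local terms do not see each other, so `K` is the only coupling, and `K ≥ 0` by the
signs. Membership in `M` becomes `A + K = 0` and `B + K = 0`, and on `M` the energy is `(P + N) /
2`. Every sign pair can be scaled into `M` by positive factors `a`, `b` (`exists_nehari_scaling`).

Existence of a minimizer (`exists_minimizer`): a minimizing sequence is bounded in `ℓ²` and has a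
pointwise limit `v` along a subsequence. Coercivity makes the terms of `⟨J'(u), u±⟩` nonnegative off
one fixed finite set, so Fatou's lemma gives `⟨J'(v), v±⟩ ≤ 0`. Neither part vanishes in the limit,
because on that finite set each part keeps mass at least `exp h₀`. Hence the factors that scale `v`
into `M` are at most `1`; since `m ≤ (a² P + b² N) / 2 ≤ (P + N) / 2 ≤ m`, both equal `1`.

Minimizers solve the equation (`residual_eq_zero`): perturb `u` at a single vertex `z` by `t` and
scale back into `M`. The energy there is at least `m`, while the same factors applied to `u` itself
give at most `m` (`nehari_value_le`). The difference of the two energies is nonnegative and equals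
`t` times the defect of the equation at `z`, up to `o(t)`. One-sided and two-sided choices of `t`,
and the symmetry `u ↦ -u`, force the defect to vanish. Summation by parts then gives the weak form.
-/

namespace FracLog

/-! ### Graph distance on the lattice and summability of negative powers. -/

section Lattice

variable {d : ℕ}

theorem latticeGraph_adj_add_single (x : Lattice d) (i : Fin d) (m : ℤ) :
    (latticeGraph d).Adj (x + (Pi.single i m : Lattice d))
      (x + (Pi.single i (m + 1) : Lattice d)) := by
  have key : ∑ j, |(x + (Pi.single i m : Lattice d)) j -
      (x + (Pi.single i (m + 1) : Lattice d)) j| = 1 := by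
    rw [Finset.sum_eq_single i]
    · simp
    · intro j _ hj
      simp [hj]
    · simp
  exact key

theorem reachable_add_single (x : Lattice d) (i : Fin d) (n : ℤ) :
    (latticeGraph d).Reachable x (x + (Pi.single i n : Lattice d)) := by
  induction n using Int.induction_on with
  | zero => rw [Pi.single_zero, add_zero]
  | succ n ih => exact ih.trans (latticeGraph_adj_add_single x i _).reachable
  | pred n ih =>
    have := latticeGraph_adj_add_single x i (-(n : ℤ) - 1)
    rw [sub_add_cancel] at this
    exact ih.trans this.symm.reachable

/-- `SimpleGraph.dist` is `0` between unreachable vertices, so a lower bound on the distance needs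
connectedness. -/
theorem latticeGraph_reachable (x y : Lattice d) : (latticeGraph d).Reachable x y := by
  have key : ∀ (s : Finset (Fin d)) (v : Lattice d),
      (latticeGraph d).Reachable x (x + ∑ i ∈ s, (Pi.single i (v i) : Lattice d)) := by
    intro s v
    induction s using Finset.induction_on with
    | empty => simp
    | insert i s hi ih =>
      rw [Finset.sum_insert hi, add_comm (Pi.single i (v i) : Lattice d), ← add_assoc]
      exact ih.trans (reachable_add_single _ _ _)
  have h := key Finset.univ (y - x)
  rwa [Finset.univ_sum_single (y - x), add_sub_cancel] at h

theorem norm_sub_le_length {x y : Lattice d} (p : (latticeGraph d).Walk x y) :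
    ‖x - y‖ ≤ p.length := by
  induction p with
  | nil => simp
  | @cons a b c hab q ih =>
    have h1 : ‖a - b‖ ≤ 1 := by
      refine (pi_norm_le_iff_of_nonneg zero_le_one).2 fun i => ?_
      have hs : ∑ i, |a i - b i| = 1 := hab
      have : |a i - b i| ≤ 1 :=
        hs ▸ Finset.single_le_sum (f := fun i => |a i - b i|) (fun j _ => abs_nonneg _)
          (Finset.mem_univ i)
      rw [Pi.sub_apply, Int.norm_eq_abs]
      exact_mod_cast this
    calc ‖a - c‖ = ‖(a - b) + (b - c)‖ := by rw [sub_add_sub_cancel]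
      _ ≤ 1 + q.length := (norm_add_le _ _).trans (add_le_add h1 ih)
      _ = _ := by rw [SimpleGraph.Walk.length_cons]; push_cast; ring

/-- This direction alone suffices: it makes balls finite and, the exponent `-d - 2s` being negative,
bounds the kernel from above by a power of the sup norm. -/
theorem norm_sub_le_latDist (x y : Lattice d) : ‖x - y‖ ≤ latDist x y := by
  obtain ⟨p, hp⟩ := (latticeGraph_reachable x y).exists_walk_length_eq_dist
  rw [latDist, ← hp]
  exact norm_sub_le_length p

theorem finite_setOf_latDist_lt (x₀ : Lattice d) (a : ℝ) : {x | latDist x x₀ < a}.Finite := by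
  refine ((isCompact_closedBall x₀ a).finite_of_discrete).subset fun x hx => ?_
  rw [Metric.mem_closedBall, dist_eq_norm]
  exact (norm_sub_le_latDist x x₀).trans hx.le

theorem PotentialCoercive.finite_sublevel {h : Lattice d → ℝ} (hh : PotentialCoercive h) (a : ℝ) :
    {x | h x ≤ a}.Finite := by
  obtain ⟨x₀, hx⟩ := hh
  have h1 := hx.eventually_gt_atTop a
  rw [eventually_comap] at h1
  obtain ⟨b, hb⟩ := eventually_atTop.1 h1
  refine (finite_setOf_latDist_lt x₀ b).subset fun x hx => ?_
  by_contra hlt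
  exact (hb _ (not_lt.1 hlt) x rfl).not_ge hx

/-- The integer vectors embed into the `ℤ`-span of the standard basis of `ℝ^d`, a lattice of rank
`d`, where the sum is known to converge. -/
theorem summable_norm_lattice_rpow (d : ℕ) {r : ℝ} (hr : r < -(d : ℝ)) :
    Summable fun z : Lattice d => ‖z‖ ^ r := by
  let b := Pi.basisFun ℝ (Fin d)
  let L : Submodule ℤ (Fin d → ℝ) := Submodule.span ℤ (Set.range b)
  have hrank : Module.finrank ℤ L = d := by
    rw [Module.finrank_eq_card_basis (b.restrictScalars ℤ), Fintype.card_fin]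
  have hs := ZLattice.summable_norm_rpow L r (by rwa [hrank])
  have hmem : ∀ z : Lattice d, (fun i => (z i : ℝ)) ∈ L := by
    intro z
    have : (fun i => (z i : ℝ)) = ∑ i, z i • b i := by
      ext j
      simp [b, Finset.sum_apply, Pi.single_apply]
    rw [this]
    exact Submodule.sum_mem _ fun i _ => Submodule.smul_mem _ _ (Submodule.subset_span ⟨i, rfl⟩)
  have hinj : Function.Injective fun z : Lattice d => (⟨_, hmem z⟩ : L) := by
    intro z z' hz
    ext i
    have : (z i : ℝ) = z' i := congrFun (congrArg Subtype.val hz) i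
    exact_mod_cast this
  refine (hs.comp_injective hinj).congr fun z => ?_
  congr 1

end Lattice

/-! ### Kernels with bounded row sums and their Dirichlet form. -/

/-- The kernel `w` with the diagonal set to `0`. -/
noncomputable def offDiag {d : ℕ} (w : Lattice d → Lattice d → ℝ) (x y : Lattice d) : ℝ :=
  open Classical in if y = x then 0 else w x y

/-- Symmetric nonnegative kernels (off the diagonal) with uniformly bounded row sums. -/
structure HasBoundedRows {d : ℕ} (w : Lattice d → Lattice d → ℝ) (W : ℝ) : Prop where
  symm : ∀ x y, offDiag w x y = offDiag w y x
  nonneg : ∀ x y, 0 ≤ offDiag w x y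
  summable_row : ∀ x, Summable (offDiag w x)
  tsum_row_le : ∀ x, ∑' y, offDiag w x y ≤ W

/-- The upper bound is dominated by a translation-invariant function, so one sum over the lattice
bounds all rows. The rest of the argument uses the kernel only through `HasBoundedRows`. -/
theorem IsFracKernel.exists_hasBoundedRows {d : ℕ} {s : ℝ} {w : Lattice d → Lattice d → ℝ}
    (hs : 0 < s) (hw : IsFracKernel s w) : ∃ W, HasBoundedRows w W := by
  obtain ⟨c, C, -, hC, hb⟩ := hw.bounds
  have hsum := (summable_norm_lattice_rpow d (r := -(d : ℝ) - 2 * s) (by linarith)).mul_left C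
  have hle : ∀ x y, offDiag w x y ≤ C * ‖x - y‖ ^ (-(d : ℝ) - 2 * s) := by
    intro x y
    unfold offDiag
    split_ifs with hxy
    · positivity
    · refine (hb x y (Ne.symm hxy)).2.trans (mul_le_mul_of_nonneg_left ?_ hC.le)
      refine Real.rpow_le_rpow_of_nonpos ?_ (norm_sub_le_latDist x y) ?_
      · exact norm_pos_iff.2 (sub_ne_zero.2 (Ne.symm hxy))
      · have : (0 : ℝ) ≤ d := Nat.cast_nonneg d
        linarith
  have hnn : ∀ x y, 0 ≤ offDiag w x y := by
    intro x y
    unfold offDiag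
    split_ifs with hxy
    · exact le_rfl
    · exact (hw.pos x y (Ne.symm hxy)).le
  have hsumx : ∀ x : Lattice d, Summable fun y => C * ‖x - y‖ ^ (-(d : ℝ) - 2 * s) := fun x =>
    hsum.comp_injective (Equiv.subLeft x).injective
  refine ⟨∑' z : Lattice d, C * ‖z‖ ^ (-(d : ℝ) - 2 * s), ?_, hnn, fun x => ?_, fun x => ?_⟩
  · intro x y
    unfold offDiag
    split_ifs with h1 h2 h2
    · rfl
    · exact absurd h1.symm h2
    · exact absurd h2.symm h1
    · exact hw.symm x y (Ne.symm h1)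
  · exact Summable.of_nonneg_of_le (hnn x) (hle x) (hsumx x)
  · rw [← (Equiv.subLeft x).tsum_eq (fun z : Lattice d => C * ‖z‖ ^ (-(d : ℝ) - 2 * s))]
    exact Summable.tsum_le_tsum (hle x)
      (Summable.of_nonneg_of_le (hnn x) (hle x) (hsumx x)) (hsumx x)

section Forms

variable {d : ℕ} {w : Lattice d → Lattice d → ℝ} {W : ℝ}

theorem indicator_ne_mul (w : Lattice d → Lattice d → ℝ) (x : Lattice d) (f : Lattice d → ℝ) :
    ({y | y ≠ x} : Set (Lattice d)).indicator (fun y => w x y * f y) =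
      fun y => offDiag w x y * f y := by
  ext y
  by_cases h : y = x
  · simp [offDiag, h]
  · simp [offDiag, h]

theorem tsum_ne_mul (w : Lattice d → Lattice d → ℝ) (x : Lattice d) (f : Lattice d → ℝ) :
    ∑' y : {y : Lattice d // y ≠ x}, w x y * f y = ∑' y, offDiag w x y * f y := by
  rw [← indicator_ne_mul]
  exact tsum_subtype {y | y ≠ x} fun y => w x y * f y

theorem summable_ne_mul_iff (w : Lattice d → Lattice d → ℝ) (x : Lattice d) (f : Lattice d → ℝ) :
    (Summable fun y : {y : Lattice d // y ≠ x} => w x y * f y) ↔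
      Summable fun y => offDiag w x y * f y := by
  rw [← indicator_ne_mul]
  exact summable_subtype_iff_indicator (s := {y | y ≠ x}) (f := fun y => w x y * f y)

theorem gradForm_eq (u v : Lattice d → ℝ) (x : Lattice d) :
    gradForm w u v x = (1 / 2) * ∑' y, offDiag w x y * ((u x - u y) * (v x - v y)) := by
  rw [gradForm, tsum_ne_mul w x fun y => (u x - u y) * (v x - v y)]

theorem fracLaplacian_eq (u : Lattice d → ℝ) (x : Lattice d) :
    fracLaplacian w u x = ∑' y, offDiag w x y * (u x - u y) := by
  rw [fracLaplacian, tsum_ne_mul w x fun y => u x - u y]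

theorem gradForm_comm (u v : Lattice d → ℝ) (x : Lattice d) :
    gradForm w u v x = gradForm w v u x := by
  simp only [gradForm_eq, mul_comm (u x - u _)]

theorem exists_abs_le_of_summable_sq {ι : Type*} {u : ι → ℝ} (hu : Summable fun x => u x ^ 2) :
    ∃ B, ∀ x, |u x| ≤ B :=
  ⟨√(∑' x, u x ^ 2), fun x => Real.abs_le_sqrt (hu.le_tsum x fun _ _ => sq_nonneg _)⟩

theorem HasBoundedRows.summable_mul (hw : HasBoundedRows w W) (x : Lattice d) {f : Lattice d → ℝ}
    {B : ℝ} (hf : ∀ y, |f y| ≤ B) : Summable fun y => offDiag w x y * f y := by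
  refine Summable.of_norm_bounded ((hw.summable_row x).mul_right B) fun y => ?_
  rw [Real.norm_eq_abs, abs_mul, abs_of_nonneg (hw.nonneg x y)]
  exact mul_le_mul_of_nonneg_left (hf y) (hw.nonneg x y)

theorem abs_sub_mul_sub_le {a b a' b' B B' : ℝ} (ha : |a| ≤ B) (hb : |b| ≤ B) (ha' : |a'| ≤ B')
    (hb' : |b'| ≤ B') : |(a - b) * (a' - b')| ≤ (B + B) * (B' + B') := by
  rw [abs_mul]
  exact mul_le_mul ((abs_sub a b).trans (add_le_add ha hb))
    ((abs_sub a' b').trans (add_le_add ha' hb')) (abs_nonneg _)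
    (add_nonneg ((abs_nonneg a).trans ha) ((abs_nonneg a).trans ha))

theorem HasBoundedRows.summable_grad (hw : HasBoundedRows w W) {u v : Lattice d → ℝ}
    (hu : Summable fun x => u x ^ 2) (hv : Summable fun x => v x ^ 2) (x : Lattice d) :
    Summable fun y => offDiag w x y * ((u x - u y) * (v x - v y)) := by
  obtain ⟨B, hB⟩ := exists_abs_le_of_summable_sq hu
  obtain ⟨B', hB'⟩ := exists_abs_le_of_summable_sq hv
  exact hw.summable_mul x fun y => abs_sub_mul_sub_le (hB x) (hB y) (hB' x) (hB' y)

theorem HasBoundedRows.summable_laplacian (hw : HasBoundedRows w W) {u : Lattice d → ℝ}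
    (hu : Summable fun x => u x ^ 2) (x : Lattice d) :
    Summable fun y => offDiag w x y * (u x - u y) := by
  obtain ⟨B, hB⟩ := exists_abs_le_of_summable_sq hu
  exact hw.summable_mul x fun y => (abs_sub _ _).trans (add_le_add (hB x) (hB y))

theorem HasBoundedRows.gradForm_linear (hw : HasBoundedRows w W) {u v φ : Lattice d → ℝ}
    (hu : Summable fun x => u x ^ 2) (hv : Summable fun x => v x ^ 2)
    (hφ : Summable fun x => φ x ^ 2) (a b : ℝ) (x : Lattice d) :
    gradForm w (fun y => a * u y + b * v y) φ x =
      a * gradForm w u φ x + b * gradForm w v φ x := by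
  simp only [gradForm_eq]
  have h1 := (hw.summable_grad hu hφ x).mul_left a
  have h2 := (hw.summable_grad hv hφ x).mul_left b
  rw [show ∀ p q : ℝ, a * (1 / 2 * p) + b * (1 / 2 * q) = 1 / 2 * (a * p + b * q) by
    intros; ring, ← tsum_mul_left (a := a), ← tsum_mul_left (a := b), ← h1.tsum_add h2]
  congr 2
  ext y
  ring

theorem HasBoundedRows.gradForm_nonneg (hw : HasBoundedRows w W) {u v : Lattice d → ℝ}
    (h : ∀ x y, 0 ≤ (u x - u y) * (v x - v y)) (x : Lattice d) : 0 ≤ gradForm w u v x := by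
  rw [gradForm_eq]
  exact mul_nonneg (by norm_num) (tsum_nonneg fun y => mul_nonneg (hw.nonneg x y) (h x y))

/-- Summing over the second variable first costs the factor `W`. This is the source of absolute
convergence over pairs, which justifies every exchange of sums below. -/
theorem HasBoundedRows.summable_prod_fst (hw : HasBoundedRows w W) {u : Lattice d → ℝ}
    (hu : Summable fun x => u x ^ 2) :
    Summable fun p : Lattice d × Lattice d => offDiag w p.1 p.2 * u p.1 ^ 2 := by
  have hnn : (0 : Lattice d × Lattice d → ℝ) ≤ fun p => offDiag w p.1 p.2 * u p.1 ^ 2 :=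
    fun p => mul_nonneg (hw.nonneg p.1 p.2) (sq_nonneg (u p.1))
  refine (summable_prod_of_nonneg hnn).2 ⟨fun x => (hw.summable_row x).mul_right (u x ^ 2), ?_⟩
  simp only [tsum_mul_right]
  exact Summable.of_nonneg_of_le
    (fun x => mul_nonneg (tsum_nonneg fun y => hw.nonneg x y) (sq_nonneg _))
    (fun x => mul_le_mul_of_nonneg_right (hw.tsum_row_le x) (sq_nonneg _)) (hu.mul_left W)

theorem HasBoundedRows.summable_prod_snd (hw : HasBoundedRows w W) {u : Lattice d → ℝ}
    (hu : Summable fun x => u x ^ 2) :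
    Summable fun p : Lattice d × Lattice d => offDiag w p.1 p.2 * u p.2 ^ 2 := by
  refine ((Equiv.prodComm _ _).summable_iff.2 (hw.summable_prod_fst hu)).congr fun p => ?_
  simp [hw.symm p.1 p.2]

theorem HasBoundedRows.summable_prod (hw : HasBoundedRows w W) {u v : Lattice d → ℝ}
    (hu : Summable fun x => u x ^ 2) (hv : Summable fun x => v x ^ 2)
    {f : Lattice d × Lattice d → ℝ}
    (hf : ∀ x y, |f (x, y)| ≤ 2 * (u x ^ 2 + u y ^ 2 + v x ^ 2 + v y ^ 2)) :
    Summable fun p : Lattice d × Lattice d => offDiag w p.1 p.2 * f p := by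
  have hs := ((((hw.summable_prod_fst hu).add (hw.summable_prod_snd hu)).add
    (hw.summable_prod_fst hv)).add (hw.summable_prod_snd hv)).mul_left 2
  refine Summable.of_norm_bounded hs fun p => ?_
  rw [Real.norm_eq_abs, abs_mul, abs_of_nonneg (hw.nonneg _ _)]
  refine (mul_le_mul_of_nonneg_left (hf p.1 p.2) (hw.nonneg _ _)).trans_eq ?_
  ring

theorem HasBoundedRows.summable_prod_grad (hw : HasBoundedRows w W) {u v : Lattice d → ℝ}
    (hu : Summable fun x => u x ^ 2) (hv : Summable fun x => v x ^ 2) :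
    Summable fun p : Lattice d × Lattice d =>
      offDiag w p.1 p.2 * ((u p.1 - u p.2) * (v p.1 - v p.2)) := by
  refine hw.summable_prod hu hv (f := fun p => (u p.1 - u p.2) * (v p.1 - v p.2)) fun x y => ?_
  rw [abs_le]
  constructor <;> nlinarith [sq_nonneg (u x - u y + (v x - v y)),
    sq_nonneg (u x - u y - (v x - v y)), sq_nonneg (u x + u y), sq_nonneg (v x + v y)]

theorem HasBoundedRows.summable_prod_laplacian (hw : HasBoundedRows w W) {u v : Lattice d → ℝ}
    (hu : Summable fun x => u x ^ 2) (hv : Summable fun x => v x ^ 2) :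
    Summable fun p : Lattice d × Lattice d => offDiag w p.1 p.2 * ((u p.1 - u p.2) * v p.1) := by
  refine hw.summable_prod hu hv (f := fun p => (u p.1 - u p.2) * v p.1) fun x y => ?_
  rw [abs_le]
  constructor <;> nlinarith [sq_nonneg (u x - u y + v x), sq_nonneg (u x - u y - v x),
    sq_nonneg (u x + u y), sq_nonneg (v y), sq_nonneg (v x)]

theorem HasBoundedRows.summable_gradForm (hw : HasBoundedRows w W) {u v : Lattice d → ℝ}
    (hu : Summable fun x => u x ^ 2) (hv : Summable fun x => v x ^ 2) :
    Summable (gradForm w u v) := by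
  refine ((hw.summable_prod_grad hu hv).prod.mul_left (1 / 2)).congr fun x => ?_
  rw [gradForm_eq]

theorem HasBoundedRows.summable_mul_fracLaplacian (hw : HasBoundedRows w W) {u v : Lattice d → ℝ}
    (hu : Summable fun x => u x ^ 2) (hv : Summable fun x => v x ^ 2) :
    Summable fun x => fracLaplacian w u x * v x := by
  refine (hw.summable_prod_laplacian hu hv).prod.congr fun x => ?_
  rw [fracLaplacian_eq, ← tsum_mul_right]
  simp only [mul_assoc]

/-- Summation by parts. -/
theorem HasBoundedRows.tsum_gradForm (hw : HasBoundedRows w W) {u v : Lattice d → ℝ}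
    (hu : Summable fun x => u x ^ 2) (hv : Summable fun x => v x ^ 2) :
    ∑' x, gradForm w u v x = ∑' x, fracLaplacian w u x * v x := by
  set F : Lattice d × Lattice d → ℝ := fun p => offDiag w p.1 p.2 * ((u p.1 - u p.2) * v p.1)
    with hFdef
  have hF : Summable F := hw.summable_prod_laplacian hu hv
  have hF' : Summable fun p => F (Equiv.prodComm _ _ p) := (Equiv.prodComm _ _).summable_iff.2 hF
  -- Symmetry of the kernel turns the term containing `v p.2` into the swapped copy of `F`; the two
  -- copies have the same sum and cancel the factor `1/2`.
  have hsplit : ∀ p : Lattice d × Lattice d,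
      offDiag w p.1 p.2 * ((u p.1 - u p.2) * (v p.1 - v p.2)) =
        F p + F (Equiv.prodComm _ _ p) := by
    intro p
    simp only [hFdef, Equiv.prodComm_apply, Prod.fst_swap, Prod.snd_swap, hw.symm p.2 p.1]
    ring
  have hL : ∑' p, F p = ∑' x, fracLaplacian w u x * v x := by
    rw [hF.tsum_prod]
    refine tsum_congr fun x => ?_
    rw [fracLaplacian_eq, ← tsum_mul_right]
    simp only [hFdef, mul_assoc]
  calc ∑' x, gradForm w u v x
      = 1 / 2 * ∑' p : Lattice d × Lattice d,
          offDiag w p.1 p.2 * ((u p.1 - u p.2) * (v p.1 - v p.2)) := by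
        rw [(hw.summable_prod_grad hu hv).tsum_prod, ← tsum_mul_left]
        exact tsum_congr fun x => gradForm_eq u v x
    _ = 1 / 2 * (∑' p, F p + ∑' p, F p) := by
        rw [tsum_congr hsplit, hF.tsum_add hF', (Equiv.prodComm _ _).tsum_eq F]
    _ = _ := by rw [hL]; ring

theorem HasBoundedRows.tendsto_gradForm (hw : HasBoundedRows w W) {u v : ℕ → Lattice d → ℝ}
    {u' v' : Lattice d → ℝ} {B : ℝ} (hu : ∀ n x, |u n x| ≤ B) (hv : ∀ n x, |v n x| ≤ B)
    (hu' : ∀ x, Tendsto (fun n => u n x) atTop (nhds (u' x)))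
    (hv' : ∀ x, Tendsto (fun n => v n x) atTop (nhds (v' x))) (x : Lattice d) :
    Tendsto (fun n => gradForm w (u n) (v n) x) atTop (nhds (gradForm w u' v' x)) := by
  simp only [gradForm_eq]
  refine Tendsto.const_mul _ ?_
  refine tendsto_tsum_of_dominated_convergence
    (bound := fun y => offDiag w x y * ((B + B) * (B + B))) ((hw.summable_row x).mul_right _)
    (fun y => (((hu' x).sub (hu' y)).mul ((hv' x).sub (hv' y))).const_mul _)
    (Eventually.of_forall fun n y => ?_)
  rw [Real.norm_eq_abs, abs_mul, abs_of_nonneg (hw.nonneg x y)]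
  exact mul_le_mul_of_nonneg_left (abs_sub_mul_sub_le (hu n x) (hu n y) (hv n x) (hv n y))
    (hw.nonneg x y)

/-- The Dirichlet form `∑ x, ∇u ∇v (x)`. -/
noncomputable def energyForm (w : Lattice d → Lattice d → ℝ) (u v : Lattice d → ℝ) : ℝ :=
  ∑' x, gradForm w u v x

theorem energyForm_comm (u v : Lattice d → ℝ) : energyForm w u v = energyForm w v u :=
  tsum_congr fun x => gradForm_comm u v x

theorem HasBoundedRows.energyForm_linear (hw : HasBoundedRows w W) {u v φ : Lattice d → ℝ}
    (hu : Summable fun x => u x ^ 2) (hv : Summable fun x => v x ^ 2)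
    (hφ : Summable fun x => φ x ^ 2) (a b : ℝ) :
    energyForm w (fun y => a * u y + b * v y) φ =
      a * energyForm w u φ + b * energyForm w v φ := by
  unfold energyForm
  rw [tsum_congr fun x => hw.gradForm_linear hu hv hφ a b x,
    ((hw.summable_gradForm hu hφ).mul_left a).tsum_add ((hw.summable_gradForm hv hφ).mul_left b),
    tsum_mul_left, tsum_mul_left]

theorem summable_sq_single (z : Lattice d) :
    Summable fun x => (Pi.single z 1 : Lattice d → ℝ) x ^ 2 :=
  summable_of_ne_finset_zero (s := {z}) fun x hx => by
    simp [Finset.notMem_singleton.1 hx]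

theorem HasBoundedRows.energyForm_single (hw : HasBoundedRows w W) {u : Lattice d → ℝ}
    (hu : Summable fun x => u x ^ 2) (z : Lattice d) :
    energyForm w u (Pi.single z 1) = fracLaplacian w u z := by
  rw [energyForm, hw.tsum_gradForm hu (summable_sq_single z), tsum_eq_single z]
  · simp
  · intro x hx
    simp [hx]

end Forms

/-! ### The functional and the Nehari conditions in terms of positive and negative parts. -/

section Functional

variable {d : ℕ} {w : Lattice d → Lattice d → ℝ} {W : ℝ} {h : Lattice d → ℝ}

/-- Functions for which every series in `J` converges. -/
structure LogDomain (h : Lattice d → ℝ) (u : Lattice d → ℝ) : Prop where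
  sq : Summable fun x => u x ^ 2
  potential : Summable fun x => h x * u x ^ 2
  entropy : Summable fun x => u x ^ 2 * Real.log (u x ^ 2)

theorem HasBoundedRows.gradForm_self_nonneg (hw : HasBoundedRows w W) (u : Lattice d → ℝ)
    (x : Lattice d) : 0 ≤ gradForm w u u x :=
  hw.gradForm_nonneg (fun _ _ => mul_self_nonneg _) x

/-- Boundedness and all gradient conditions follow from square summability, so only local series
remain. -/
theorem HasBoundedRows.mem_domJ_iff (hw : HasBoundedRows w W) {u : Lattice d → ℝ} :
    u ∈ domJ w h ↔ LogDomain h u := by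
  have habs : ∀ x, u x ^ 2 * |Real.log (u x ^ 2)| = |u x ^ 2 * Real.log (u x ^ 2)| := fun x => by
    rw [abs_mul, abs_of_nonneg (sq_nonneg (u x))]
  constructor
  · rintro ⟨⟨⟨-, -, hE⟩, hP⟩, hl⟩
    have hsq : Summable fun x => u x ^ 2 :=
      Summable.of_nonneg_of_le (fun x => sq_nonneg _)
        (fun x => le_add_of_nonneg_left (hw.gradForm_self_nonneg u x)) hE
    refine ⟨hsq, (hP.sub hsq).congr fun x => by ring, ?_⟩
    simp only [habs] at hl
    exact hl.of_abs
  · rintro ⟨hsq, hP, hl⟩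
    refine ⟨⟨⟨exists_abs_le_of_summable_sq hsq, fun x => ?_,
      (hw.summable_gradForm hsq hsq).add hsq⟩, (hP.add hsq).congr fun x => by ring⟩, ?_⟩
    · rw [summable_ne_mul_iff w x fun y => (u x - u y) * (u x - u y)]
      exact hw.summable_grad hsq hsq x
    · simp only [habs]
      exact hl.abs

theorem mul_sq_mul_log_mul_sq (a t : ℝ) (ha : a ≠ 0) :
    (a * t) ^ 2 * Real.log ((a * t) ^ 2) =
      a ^ 2 * (t ^ 2 * Real.log (t ^ 2)) + a ^ 2 * Real.log (a ^ 2) * t ^ 2 := by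
  by_cases ht : t = 0
  · simp [ht]
  · rw [mul_pow, Real.log_mul (by positivity) (by positivity)]
    ring

theorem LogDomain.smul {u : Lattice d → ℝ} (hu : LogDomain h u) {a : ℝ} (ha : a ≠ 0) :
    LogDomain h fun x => a * u x where
  sq := (hu.sq.mul_left (a ^ 2)).congr fun x => by ring
  potential := (hu.potential.mul_left (a ^ 2)).congr fun x => by ring
  entropy := ((hu.entropy.mul_left (a ^ 2)).add
    (hu.sq.mul_left (a ^ 2 * Real.log (a ^ 2)))).congr fun x =>
      (mul_sq_mul_log_mul_sq a (u x) ha).symm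

/-- Applied vertex by vertex, this makes every local term additive on functions with disjoint
supports; only the nonlocal form produces a cross term. -/
theorem add_mul_self_of_disjoint {s t : ℝ} (hst : s * t = 0) (f : ℝ → ℝ) (hf : f 0 = 0) :
    f (s + t) = f s + f t := by
  rcases mul_eq_zero.1 hst with rfl | rfl <;> simp [hf]

theorem LogDomain.add {u v : Lattice d → ℝ} (hu : LogDomain h u) (hv : LogDomain h v)
    (huv : ∀ x, u x * v x = 0) : LogDomain h fun x => u x + v x where
  sq := (hu.sq.add hv.sq).congr fun x =>
    (add_mul_self_of_disjoint (huv x) (fun t => t ^ 2) (by simp)).symm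
  potential := (hu.potential.add hv.potential).congr fun x =>
    (add_mul_self_of_disjoint (huv x) (fun t => h x * t ^ 2) (by simp)).symm
  entropy := (hu.entropy.add hv.entropy).congr fun x =>
    (add_mul_self_of_disjoint (huv x) (fun t => t ^ 2 * Real.log (t ^ 2)) (by simp)).symm

theorem LogDomain.of_zero_or_eq {u v : Lattice d → ℝ} (hu : LogDomain h u)
    (hv : ∀ x, v x = 0 ∨ v x = u x) : LogDomain h v where
  sq := Summable.of_norm_bounded hu.sq.norm fun x => by
    rcases hv x with hx | hx <;> simp [hx, sq_nonneg]
  potential := Summable.of_norm_bounded hu.potential.norm fun x => by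
    rcases hv x with hx | hx
    · simp only [hx, ne_eq, OfNat.ofNat_ne_zero, not_false_eq_true, zero_pow, mul_zero, norm_zero]
      exact norm_nonneg _
    · rw [hx]
  entropy := Summable.of_norm_bounded hu.entropy.norm fun x => by
    rcases hv x with hx | hx
    · simp only [hx, ne_eq, OfNat.ofNat_ne_zero, not_false_eq_true, zero_pow, zero_mul, norm_zero]
      exact norm_nonneg _
    · rw [hx]

theorem LogDomain.congr_off {u v : Lattice d → ℝ} (hu : LogDomain h u) (z : Lattice d)
    (hv : ∀ x, x ≠ z → v x = u x) : LogDomain h v := by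
  have hz : ∀ᶠ x in cofinite, v x = u x := by
    refine (Set.finite_singleton z).subset fun x hx => ?_
    by_contra hne
    exact hx (hv x hne)
  refine ⟨(summable_congr_cofinite ?_).2 hu.sq, (summable_congr_cofinite ?_).2 hu.potential,
    (summable_congr_cofinite ?_).2 hu.entropy⟩ <;>
  · filter_upwards [hz] with x hx
    simp only [hx]

theorem LogDomain.zero : LogDomain h fun _ => 0 := by
  constructor <;> simp [summable_zero]

theorem LogDomain.uPlus {u : Lattice d → ℝ} (hu : LogDomain h u) : LogDomain h (uPlus u) :=
  hu.of_zero_or_eq fun x => (max_choice (u x) 0).symm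

theorem LogDomain.uMinus {u : Lattice d → ℝ} (hu : LogDomain h u) : LogDomain h (uMinus u) :=
  hu.of_zero_or_eq fun x => (min_choice (u x) 0).symm

/-- `‖u‖²` in `ℓ²`. -/
noncomputable def sqSum (u : Lattice d → ℝ) : ℝ := ∑' x, u x ^ 2

/-- The number `⟨J'(u), u⟩`, for `u` in the domain of `J`. -/
noncomputable def nehariForm (w : Lattice d → Lattice d → ℝ) (h u : Lattice d → ℝ) : ℝ :=
  energyForm w u u + ∑' x, h x * u x ^ 2 - ∑' x, u x ^ 2 * Real.log (u x ^ 2)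

theorem HasBoundedRows.energyJ_eq (hw : HasBoundedRows w W) {u : Lattice d → ℝ}
    (hu : LogDomain h u) : energyJ w h u = 1 / 2 * (nehariForm w h u + sqSum u) := by
  have h1 : ∑' x, (gradForm w u u x + (h x + 1) * u x ^ 2) =
      energyForm w u u + (∑' x, h x * u x ^ 2 + ∑' x, u x ^ 2) := by
    rw [energyForm, ← hu.potential.tsum_add hu.sq,
      ← (hw.summable_gradForm hu.sq hu.sq).tsum_add (hu.potential.add hu.sq)]
    exact tsum_congr fun x => by ring
  rw [energyJ, nehariForm, sqSum, h1]
  ring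

theorem HasBoundedRows.derivJ_add_left (hw : HasBoundedRows w W) {p q : Lattice d → ℝ}
    (hp : LogDomain h p) (hq : LogDomain h q) (hpq : ∀ x, p x * q x = 0) :
    derivJ w h (fun x => p x + q x) p = nehariForm w h p + energyForm w p q := by
  have h1 : ∀ x, gradForm w (fun x => p x + q x) p x + h x * ((p x + q x) * p x) =
      gradForm w p p x + gradForm w p q x + h x * p x ^ 2 := by
    intro x
    have hl := hw.gradForm_linear hp.sq hq.sq hp.sq 1 1 x
    simp only [one_mul] at hl
    rw [hl, gradForm_comm q p]
    linear_combination h x * hpq x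
  have h2 : ∀ x, (p x + q x) * p x * Real.log ((p x + q x) ^ 2) =
      p x ^ 2 * Real.log (p x ^ 2) := by
    intro x
    rcases mul_eq_zero.1 (hpq x) with hx | hx
    · simp [hx]
    · simp [hx, pow_two]
  rw [derivJ, tsum_congr h1, tsum_congr h2,
    ((hw.summable_gradForm hp.sq hp.sq).add (hw.summable_gradForm hp.sq hq.sq)).tsum_add
      hp.potential,
    (hw.summable_gradForm hp.sq hp.sq).tsum_add (hw.summable_gradForm hp.sq hq.sq),
    nehariForm, energyForm, energyForm]
  ring

theorem HasBoundedRows.nehariForm_add (hw : HasBoundedRows w W) {p q : Lattice d → ℝ}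
    (hp : LogDomain h p) (hq : LogDomain h q) (hpq : ∀ x, p x * q x = 0) :
    nehariForm w h (fun x => p x + q x) =
      nehariForm w h p + nehariForm w h q + 2 * energyForm w p q := by
  have hE : energyForm w (fun x => p x + q x) (fun x => p x + q x) =
      energyForm w p p + energyForm w q q + 2 * energyForm w p q := by
    have h1 := hw.energyForm_linear hp.sq hq.sq (hp.add hq hpq).sq 1 1
    have h2 := hw.energyForm_linear hp.sq hq.sq hp.sq 1 1
    have h3 := hw.energyForm_linear hp.sq hq.sq hq.sq 1 1
    simp only [one_mul] at h1 h2 h3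
    rw [h1, energyForm_comm p, energyForm_comm q, h2, h3, energyForm_comm q p]
    ring
  have hP : ∑' x, h x * (p x + q x) ^ 2 = ∑' x, h x * p x ^ 2 + ∑' x, h x * q x ^ 2 := by
    rw [← hp.potential.tsum_add hq.potential]
    exact tsum_congr fun x =>
      add_mul_self_of_disjoint (hpq x) (fun t => h x * t ^ 2) (by simp)
  have hL : ∑' x, (p x + q x) ^ 2 * Real.log ((p x + q x) ^ 2) =
      ∑' x, p x ^ 2 * Real.log (p x ^ 2) + ∑' x, q x ^ 2 * Real.log (q x ^ 2) := by
    rw [← hp.entropy.tsum_add hq.entropy]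
    exact tsum_congr fun x =>
      add_mul_self_of_disjoint (hpq x) (fun t => t ^ 2 * Real.log (t ^ 2)) (by simp)
  rw [nehariForm, nehariForm, nehariForm, hE, hP, hL]
  ring

theorem sqSum_add {p q : Lattice d → ℝ} (hp : LogDomain h p) (hq : LogDomain h q)
    (hpq : ∀ x, p x * q x = 0) : sqSum (fun x => p x + q x) = sqSum p + sqSum q := by
  rw [sqSum, sqSum, sqSum, ← hp.sq.tsum_add hq.sq]
  exact tsum_congr fun x => add_mul_self_of_disjoint (hpq x) (fun t => t ^ 2) (by simp)

theorem sqSum_smul (a : ℝ) (u : Lattice d → ℝ) : sqSum (fun x => a * u x) = a ^ 2 * sqSum u := by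
  simp only [sqSum, mul_pow, tsum_mul_left]

theorem HasBoundedRows.energyForm_smul (hw : HasBoundedRows w W) {u v : Lattice d → ℝ}
    (hu : Summable fun x => u x ^ 2) (hv : Summable fun x => v x ^ 2) (a b : ℝ) :
    energyForm w (fun x => a * u x) (fun x => b * v x) = a * b * energyForm w u v := by
  have hbv : Summable fun x => (b * v x) ^ 2 := (hv.mul_left (b ^ 2)).congr fun x => by ring
  have h1 := hw.energyForm_linear hu hu hbv a 0
  have h2 := hw.energyForm_linear hv hv hu b 0
  simp only [zero_mul, add_zero] at h1 h2
  rw [h1, energyForm_comm u, h2, energyForm_comm v]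
  ring

theorem HasBoundedRows.nehariForm_smul (hw : HasBoundedRows w W) {u : Lattice d → ℝ}
    (hu : LogDomain h u) {a : ℝ} (ha : a ≠ 0) :
    nehariForm w h (fun x => a * u x) =
      a ^ 2 * (nehariForm w h u - Real.log (a ^ 2) * sqSum u) := by
  have hL : ∑' x, (a * u x) ^ 2 * Real.log ((a * u x) ^ 2) =
      a ^ 2 * ∑' x, u x ^ 2 * Real.log (u x ^ 2) + a ^ 2 * Real.log (a ^ 2) * sqSum u := by
    rw [sqSum, ← tsum_mul_left, ← tsum_mul_left,
      ← (hu.entropy.mul_left _).tsum_add (hu.sq.mul_left _)]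
    exact tsum_congr fun x => mul_sq_mul_log_mul_sq a (u x) ha
  have hP : ∑' x, h x * (a * u x) ^ 2 = a ^ 2 * ∑' x, h x * u x ^ 2 := by
    rw [← tsum_mul_left]
    exact tsum_congr fun x => by ring
  rw [nehariForm, nehariForm, hw.energyForm_smul hu.sq hu.sq, hL, hP]
  ring

theorem uPlus_add_uMinus (u : Lattice d → ℝ) (x : Lattice d) : uPlus u x + uMinus u x = u x := by
  simp [uPlus, uMinus]

theorem uPlus_mul_uMinus (u : Lattice d → ℝ) (x : Lattice d) : uPlus u x * uMinus u x = 0 := by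
  simp [uPlus, uMinus]

theorem uPlus_nonneg (u : Lattice d → ℝ) (x : Lattice d) : 0 ≤ uPlus u x := le_max_right _ _

theorem uMinus_nonpos (u : Lattice d → ℝ) (x : Lattice d) : uMinus u x ≤ 0 := min_le_right _ _

/-- Pairs `(p, q)` of functions that are the positive and negative parts of a sign-changing
function in the domain of `J`. -/
structure SignPair (h p q : Lattice d → ℝ) : Prop where
  left : LogDomain h p
  right : LogDomain h q
  nonneg : ∀ x, 0 ≤ p x
  nonpos : ∀ x, q x ≤ 0
  disjoint : ∀ x, p x * q x = 0
  left_ne : p ≠ 0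
  right_ne : q ≠ 0

theorem LogDomain.signPair {u : Lattice d → ℝ} (hu : LogDomain h u) (hp : FracLog.uPlus u ≠ 0)
    (hm : FracLog.uMinus u ≠ 0) : SignPair h (FracLog.uPlus u) (FracLog.uMinus u) :=
  ⟨hu.uPlus, hu.uMinus, uPlus_nonneg u, uMinus_nonpos u, uPlus_mul_uMinus u, hp, hm⟩

theorem sqSum_pos {u : Lattice d → ℝ} (hu : Summable fun x => u x ^ 2) (h0 : u ≠ 0) :
    0 < sqSum u := by
  obtain ⟨x, hx⟩ := Function.ne_iff.1 h0
  have hx' : u x ≠ 0 := hx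
  exact hu.tsum_pos (fun _ => sq_nonneg _) x (by positivity)

namespace SignPair

variable {p q : Lattice d → ℝ}

theorem smul (hpq : SignPair h p q) {a b : ℝ} (ha : 0 < a) (hb : 0 < b) :
    SignPair h (fun x => a * p x) (fun x => b * q x) where
  left := hpq.left.smul ha.ne'
  right := hpq.right.smul hb.ne'
  nonneg x := mul_nonneg ha.le (hpq.nonneg x)
  nonpos x := mul_nonpos_of_nonneg_of_nonpos hb.le (hpq.nonpos x)
  disjoint x := by linear_combination a * b * hpq.disjoint x
  left_ne := by
    obtain ⟨x, hx⟩ := Function.ne_iff.1 hpq.left_ne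
    exact Function.ne_iff.2 ⟨x, mul_ne_zero ha.ne' hx⟩
  right_ne := by
    obtain ⟨x, hx⟩ := Function.ne_iff.1 hpq.right_ne
    exact Function.ne_iff.2 ⟨x, mul_ne_zero hb.ne' hx⟩

theorem uPlus_add (hpq : SignPair h p q) : uPlus (fun x => p x + q x) = p := by
  ext x
  rcases mul_eq_zero.1 (hpq.disjoint x) with hx | hx
  · simp [uPlus, hx, hpq.nonpos x]
  · simp [uPlus, hx, hpq.nonneg x]

theorem uMinus_add (hpq : SignPair h p q) : uMinus (fun x => p x + q x) = q := by
  ext x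
  rcases mul_eq_zero.1 (hpq.disjoint x) with hx | hx
  · simp [uMinus, hx, hpq.nonpos x]
  · simp [uMinus, hx, hpq.nonneg x]

/-- Disjointness leaves only `-p x * q y - p y * q x`, where both terms are nonnegative. Hence the
coupling `K` is nonnegative. -/
theorem sub_mul_sub_nonneg (hpq : SignPair h p q) (x y : Lattice d) :
    0 ≤ (p x - p y) * (q x - q y) := by
  nlinarith [hpq.disjoint x, hpq.disjoint y,
    mul_nonneg (hpq.nonneg x) (neg_nonneg.2 (hpq.nonpos y)),
    mul_nonneg (hpq.nonneg y) (neg_nonneg.2 (hpq.nonpos x))]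

theorem energyForm_nonneg (hpq : SignPair h p q) (hw : HasBoundedRows w W) :
    0 ≤ energyForm w p q :=
  tsum_nonneg fun x => hw.gradForm_nonneg hpq.sub_mul_sub_nonneg x

theorem mem_nehariSC_iff (hpq : SignPair h p q) (hw : HasBoundedRows w W) :
    (fun x => p x + q x) ∈ nehariSC w h ↔
      nehariForm w h p + energyForm w p q = 0 ∧ nehariForm w h q + energyForm w p q = 0 := by
  have hq : derivJ w h (fun x => p x + q x) q = nehariForm w h q + energyForm w p q := by
    have := hw.derivJ_add_left hpq.right hpq.left fun x => by
      rw [mul_comm]; exact hpq.disjoint x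
    rw [energyForm_comm q p] at this
    rw [← this]
    simp only [add_comm (q _)]
  unfold nehariSC
  rw [Set.mem_ofPred_eq, hpq.uPlus_add, hpq.uMinus_add, hw.mem_domJ_iff,
    hw.derivJ_add_left hpq.left hpq.right hpq.disjoint, hq]
  exact ⟨fun H => H.2.2.2, fun H => ⟨hpq.left.add hpq.right hpq.disjoint, hpq.left_ne,
    hpq.right_ne, H⟩⟩

theorem energyJ_add (hpq : SignPair h p q) (hw : HasBoundedRows w W) :
    energyJ w h (fun x => p x + q x) =
      1 / 2 * (nehariForm w h p + nehariForm w h q + 2 * energyForm w p q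
        + sqSum p + sqSum q) := by
  rw [hw.energyJ_eq (hpq.left.add hpq.right hpq.disjoint),
    hw.nehariForm_add hpq.left hpq.right hpq.disjoint, sqSum_add hpq.left hpq.right hpq.disjoint]
  ring

/-- Each Nehari equation carries a common factor `a` or `b`, which is divided out; finding a scaling
into `M` is now a problem about five real numbers. -/
theorem smul_mem_nehariSC_iff (hpq : SignPair h p q) (hw : HasBoundedRows w W) {a b : ℝ}
    (ha : 0 < a) (hb : 0 < b) :
    (fun x => a * p x + b * q x) ∈ nehariSC w h ↔
      a * (nehariForm w h p - Real.log (a ^ 2) * sqSum p) + b * energyForm w p q = 0 ∧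
      b * (nehariForm w h q - Real.log (b ^ 2) * sqSum q) + a * energyForm w p q = 0 := by
  rw [(hpq.smul ha hb).mem_nehariSC_iff hw, hw.nehariForm_smul hpq.left ha.ne',
    hw.nehariForm_smul hpq.right hb.ne', hw.energyForm_smul hpq.left.sq hpq.right.sq]
  constructor
  · rintro ⟨h1, h2⟩
    exact ⟨mul_left_cancel₀ ha.ne' (by linear_combination h1),
      mul_left_cancel₀ hb.ne' (by linear_combination h2)⟩
  · rintro ⟨h1, h2⟩
    exact ⟨by linear_combination a * h1, by linear_combination b * h2⟩

theorem energyJ_smul (hpq : SignPair h p q) (hw : HasBoundedRows w W) {a b : ℝ}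
    (ha : 0 < a) (hb : 0 < b) :
    energyJ w h (fun x => a * p x + b * q x) =
      1 / 2 * (a ^ 2 * (nehariForm w h p - Real.log (a ^ 2) * sqSum p + sqSum p) +
        b ^ 2 * (nehariForm w h q - Real.log (b ^ 2) * sqSum q + sqSum q) +
        2 * (a * b) * energyForm w p q) := by
  rw [(hpq.smul ha hb).energyJ_add hw, hw.nehariForm_smul hpq.left ha.ne',
    hw.nehariForm_smul hpq.right hb.ne', hw.energyForm_smul hpq.left.sq hpq.right.sq,
    sqSum_smul, sqSum_smul]
  ring

end SignPair

theorem eq_uPlus_add_uMinus (u : Lattice d → ℝ) : u = fun x => uPlus u x + uMinus u x :=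
  funext fun x => (uPlus_add_uMinus u x).symm

theorem HasBoundedRows.signPair_of_mem (hw : HasBoundedRows w W) {u : Lattice d → ℝ}
    (hu : u ∈ nehariSC w h) : SignPair h (uPlus u) (uMinus u) :=
  (hw.mem_domJ_iff.1 hu.1).signPair hu.2.1 hu.2.2.1

theorem HasBoundedRows.nehari_eqs (hw : HasBoundedRows w W) {u : Lattice d → ℝ}
    (hu : u ∈ nehariSC w h) :
    nehariForm w h (uPlus u) + energyForm w (uPlus u) (uMinus u) = 0 ∧
      nehariForm w h (uMinus u) + energyForm w (uPlus u) (uMinus u) = 0 := by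
  rw [← (hw.signPair_of_mem hu).mem_nehariSC_iff hw, ← eq_uPlus_add_uMinus]
  exact hu

theorem HasBoundedRows.energyJ_of_mem (hw : HasBoundedRows w W) {u : Lattice d → ℝ}
    (hu : u ∈ nehariSC w h) :
    energyJ w h u = 1 / 2 * (sqSum (uPlus u) + sqSum (uMinus u)) := by
  obtain ⟨h1, h2⟩ := hw.nehari_eqs hu
  have := (hw.signPair_of_mem hu).energyJ_add hw
  rw [← eq_uPlus_add_uMinus] at this
  rw [this]
  linear_combination (1 / 2) * h1 + (1 / 2) * h2

end Functional

/-! ### Scaling factors for the Nehari equations, and Fatou's lemma for series. -/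

section RealAnalysis

/-- With `b = a * exp θ` the Nehari equations give `log a²` and `log b²` explicitly, and they are
compatible iff this equation for `θ` holds. The difference of its two sides is `2θ` plus a
nondecreasing function of `θ`, so it changes sign between `-M` and `M`, where `M` is the absolute
value at `θ = 0`. The bound on `θ` later replaces a continuity or implicit function argument. -/
theorem exists_nehari_angle {A B K P N : ℝ} (hP : 0 < P) (hN : 0 < N) (hK : 0 ≤ K) :
    ∃ θ : ℝ, |θ| ≤ |(A + K) / P - (B + K) / N| ∧
      2 * θ + (A + Real.exp θ * K) / P = (B + Real.exp (-θ) * K) / N := by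
  set M := |(A + K) / P - (B + K) / N| with hM
  have hM0 : 0 ≤ M := abs_nonneg _
  have hc : Continuous fun θ : ℝ =>
      2 * θ + (A + Real.exp θ * K) / P - (B + Real.exp (-θ) * K) / N := by fun_prop
  have hmono : ∀ s t : ℝ, s ≤ t → (A + Real.exp s * K) / P - (B + Real.exp (-s) * K) / N ≤
      (A + Real.exp t * K) / P - (B + Real.exp (-t) * K) / N := by
    intro s t hst
    gcongr
  have h1 := hmono 0 M hM0
  have h2 := hmono (-M) 0 (by linarith)
  simp only [Real.exp_zero, neg_zero, one_mul] at h1 h2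
  have h3 := neg_abs_le ((A + K) / P - (B + K) / N)
  have h4 := le_abs_self ((A + K) / P - (B + K) / N)
  rw [← hM] at h3 h4
  obtain ⟨θ, hθ, h0⟩ := intermediate_value_Icc (a := -M) (b := M) (by linarith) hc.continuousOn
    (show (0 : ℝ) ∈ Set.Icc _ _ from ⟨by linarith, by linarith⟩)
  exact ⟨θ, abs_le.2 hθ, by simp only at h0; linarith⟩

theorem exists_nehari_scaling {A B K P N : ℝ} (hP : 0 < P) (hN : 0 < N) (hK : 0 ≤ K) :
    ∃ θ a b : ℝ, |θ| ≤ |(A + K) / P - (B + K) / N| ∧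
      a = Real.exp ((A + Real.exp θ * K) / P / 2) ∧ b = a * Real.exp θ ∧
      a * (A - Real.log (a ^ 2) * P) + b * K = 0 ∧
        b * (B - Real.log (b ^ 2) * N) + a * K = 0 := by
  obtain ⟨θ, hθ, h0⟩ := exists_nehari_angle (A := A) (B := B) hP hN hK
  obtain ⟨a, ha⟩ : ∃ a, a = Real.exp ((A + Real.exp θ * K) / P / 2) := ⟨_, rfl⟩
  refine ⟨θ, a, _, hθ, ha, rfl, ?_⟩
  have hapos : 0 < a := ha ▸ Real.exp_pos _
  have hla : Real.log (a ^ 2) = (A + Real.exp θ * K) / P := by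
    rw [Real.log_pow, ha, Real.log_exp]
    push_cast
    ring
  have hlb : Real.log ((a * Real.exp θ) ^ 2) = (B + Real.exp (-θ) * K) / N := by
    rw [mul_pow, Real.log_mul (by positivity) (by positivity), hla, Real.log_pow, Real.log_exp]
    push_cast
    linarith
  rw [hla, hlb, div_mul_cancel₀ _ hP.ne', div_mul_cancel₀ _ hN.ne', Real.exp_neg]
  constructor
  · ring
  · field_simp
    ring

/-- For the larger factor `a`, dividing by `a` gives `log (a²) * P = A + (b / a) * K ≤ A + K ≤ 0`.
-/
theorem nehari_scaling_le_one {A K P a b : ℝ} (hP : 0 < P) (hK : 0 ≤ K) (ha : 0 < a)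
    (hAK : A + K ≤ 0) (hba : b ≤ a) (he : a * (A - Real.log (a ^ 2) * P) + b * K = 0) :
    a ≤ 1 := by
  by_contra! h1
  have hl : 0 < Real.log (a ^ 2) := Real.log_pos (by nlinarith)
  nlinarith [mul_pos (mul_pos ha hl) hP, mul_le_mul_of_nonneg_right hba hK,
    mul_nonneg ha.le (neg_nonneg.2 hAK)]

/-- Fatou's lemma for series whose terms are nonnegative off a finite set. -/
theorem summable_and_tsum_le_of_tendsto {ι : Type*} {f : ℕ → ι → ℝ} {g : ι → ℝ} {c : ℕ → ℝ}
    {c' : ℝ} (F : Finset ι) (hnn : ∀ n, ∀ x ∉ F, 0 ≤ f n x) (hs : ∀ n, Summable (f n))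
    (hle : ∀ n, ∑' x, f n x ≤ c n) (hc : Tendsto c atTop (nhds c'))
    (hg : ∀ x, Tendsto (fun n => f n x) atTop (nhds (g x))) :
    Summable g ∧ ∑' x, g x ≤ c' := by
  classical
  have hg0 : ∀ x ∉ F, 0 ≤ g x := fun x hx =>
    ge_of_tendsto' (hg x) fun n => hnn n x hx
  have hfin : ∀ S : Finset ι, F ⊆ S → ∑ x ∈ S, g x ≤ c' := fun S hS =>
    le_of_tendsto_of_tendsto' (tendsto_finsetSum S fun x _ => hg x) hc fun n =>
      ((hs n).sum_le_tsum S fun x hx => hnn n x fun hxF => hx (hS hxF)).trans (hle n)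
  -- The limit may be negative on `F`; with `F` removed, bounded partial sums of nonnegative terms
  -- suffice.
  have hsum' : Summable fun x => if x ∈ F then 0 else g x := by
    refine summable_of_sum_le (c := c' - ∑ x ∈ F, g x) (fun x => ?_) fun S => ?_
    · split_ifs with hx
      · exact le_rfl
      · exact hg0 x hx
    · have h1 : ∑ x ∈ S, (if x ∈ F then 0 else g x) = ∑ x ∈ S \ F, g x := by
        rw [Finset.sum_ite, Finset.sum_const_zero, zero_add, Finset.sdiff_eq_filter]
      have h2 := hfin (F ∪ S) Finset.subset_union_left
      rw [← Finset.union_sdiff_self_eq_union, Finset.sum_union Finset.disjoint_sdiff] at h2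
      rw [h1]
      linarith
  have hsum : Summable g := by
    refine (summable_congr_cofinite ?_).1 hsum'
    filter_upwards [F.finite_toSet.compl_mem_cofinite] with x hx
    have hx' : x ∉ F := hx
    simp [hx']
  exact ⟨hsum, le_of_tendsto hsum.hasSum (eventually_atTop.2 ⟨F, hfin⟩)⟩

end RealAnalysis

/-! ### Existence of a minimizer on the sign-changing Nehari set. -/

section Minimizer

variable {d : ℕ} {w : Lattice d → Lattice d → ℝ} {W : ℝ} {h : Lattice d → ℝ}

namespace SignPair

variable {p q : Lattice d → ℝ}

theorem sqSum_left_pos (hpq : SignPair h p q) : 0 < sqSum p := sqSum_pos hpq.left.sq hpq.left_ne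

theorem sqSum_right_pos (hpq : SignPair h p q) : 0 < sqSum q :=
  sqSum_pos hpq.right.sq hpq.right_ne

theorem exists_smul_mem_nehariSC (hpq : SignPair h p q) (hw : HasBoundedRows w W) :
    ∃ a b : ℝ, 0 < a ∧ 0 < b ∧ (fun x => a * p x + b * q x) ∈ nehariSC w h := by
  obtain ⟨θ, a, b, -, ha, hb, hab⟩ := exists_nehari_scaling (A := nehariForm w h p)
    (B := nehariForm w h q) hpq.sqSum_left_pos hpq.sqSum_right_pos (hpq.energyForm_nonneg hw)
  have ha0 : 0 < a := ha ▸ Real.exp_pos _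
  have hb0 : 0 < b := hb ▸ mul_pos ha0 (Real.exp_pos _)
  exact ⟨a, b, ha0, hb0, (hpq.smul_mem_nehariSC_iff hw ha0 hb0).2 hab⟩

theorem energyJ_of_smul_mem (hpq : SignPair h p q) (hw : HasBoundedRows w W) {a b : ℝ}
    (ha : 0 < a) (hb : 0 < b) (hm : (fun x => a * p x + b * q x) ∈ nehariSC w h) :
    energyJ w h (fun x => a * p x + b * q x) = 1 / 2 * (a ^ 2 * sqSum p + b ^ 2 * sqSum q) := by
  obtain ⟨h1, h2⟩ := (hpq.smul_mem_nehariSC_iff hw ha hb).1 hm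
  rw [hpq.energyJ_smul hw ha hb]
  linear_combination a / 2 * h1 + b / 2 * h2

end SignPair

/-- Otherwise every term `u² (h - log u²)` with `u x ≠ 0` would be positive. Such a vertex satisfies
`u x ^ 2 ≥ exp (h x)`, which yields both the lower bound on `J` and the nontriviality of limits. -/
theorem exists_potential_le_log {u : Lattice d → ℝ} (hu : LogDomain h u) (h0 : u ≠ 0)
    (hle : ∑' x, h x * u x ^ 2 - ∑' x, u x ^ 2 * Real.log (u x ^ 2) ≤ 0) :
    ∃ x, u x ≠ 0 ∧ h x ≤ Real.log (u x ^ 2) := by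
  by_contra! hcon
  obtain ⟨z, hz⟩ := Function.ne_iff.1 h0
  have hz' : u z ≠ 0 := hz
  have hpos : 0 < ∑' x, (h x * u x ^ 2 - u x ^ 2 * Real.log (u x ^ 2)) := by
    refine (hu.potential.sub hu.entropy).tsum_pos (fun x => ?_) z ?_
    · by_cases hx : u x = 0
      · simp [hx]
      · nlinarith [hcon x hx, sq_nonneg (u x)]
    · have : 0 < u z ^ 2 := by positivity
      nlinarith [hcon z hz']
  rw [hu.potential.tsum_sub hu.entropy] at hpos
  linarith

theorem HasBoundedRows.exists_potential_le_log (hw : HasBoundedRows w W) {p q : Lattice d → ℝ}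
    (hp : LogDomain h p) (hp0 : p ≠ 0)
    (hsub : ∀ x y, 0 ≤ (p x - p y) * (q x - q y))
    (he : nehariForm w h p + energyForm w p q = 0) :
    ∃ x, p x ≠ 0 ∧ h x ≤ Real.log (p x ^ 2) := by
  have h1 : 0 ≤ energyForm w p q := tsum_nonneg fun x => hw.gradForm_nonneg hsub x
  have h2 : 0 ≤ energyForm w p p := tsum_nonneg fun x => hw.gradForm_self_nonneg p x
  refine FracLog.exists_potential_le_log hp hp0 ?_
  rw [nehariForm] at he
  linarith

theorem HasBoundedRows.exp_le_energyJ (hw : HasBoundedRows w W) {h₀ : ℝ} (hh : ∀ x, h₀ ≤ h x)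
    {u : Lattice d → ℝ} (hu : u ∈ nehariSC w h) : 1 / 2 * Real.exp h₀ ≤ energyJ w h u := by
  have hs := hw.signPair_of_mem hu
  obtain ⟨x, hx0, hx⟩ := hw.exists_potential_le_log hs.left hs.left_ne hs.sub_mul_sub_nonneg
    (hw.nehari_eqs hu).1
  have h1 : Real.exp h₀ ≤ uPlus u x ^ 2 :=
    (Real.le_log_iff_exp_le (by positivity)).1 ((hh x).trans hx)
  have h2 : uPlus u x ^ 2 ≤ sqSum (uPlus u) := hs.left.sq.le_tsum x fun _ _ => sq_nonneg _
  rw [hw.energyJ_of_mem hu]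
  linarith [hs.sqSum_right_pos]

/-- Two unit masses of opposite sign at distinct vertices are scaled into `M`; `d ≥ 1` makes the two
vertices distinct. -/
theorem nehariSC_nonempty (hw : HasBoundedRows w W) (hd : 1 ≤ d) : (nehariSC w h).Nonempty := by
  have hz : (0 : Lattice d) ≠ 1 := fun H => by
    have := congrFun H ⟨0, hd⟩
    simp at this
  have hpq : SignPair h (Pi.single (0 : Lattice d) (1 : ℝ) : Lattice d → ℝ)
      (Pi.single (1 : Lattice d) (-1 : ℝ) : Lattice d → ℝ) := by
    refine ⟨LogDomain.zero.congr_off 0 fun x hx => by simp [hx],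
      LogDomain.zero.congr_off 1 fun x hx => by simp [hx], fun x => ?_, fun x => ?_, fun x => ?_,
      ?_, ?_⟩
    · by_cases hx : x = 0 <;> simp [hx]
    · by_cases hx : x = 1 <;> simp [hx]
    · by_cases hx : x = 0
      · simp [hx, hz]
      · simp [hx]
    · exact Function.ne_iff.2 ⟨0, by simp⟩
    · exact Function.ne_iff.2 ⟨1, by simp⟩
  obtain ⟨a, b, -, -, hm⟩ := hpq.exists_smul_mem_nehariSC hw
  exact ⟨_, hm⟩

/-- Passage to the limit in one Nehari condition, stated for `p` so that it serves both parts. Since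
`p² ≤ R`, the terms of the series are nonnegative wherever `h > log R`, that is off a finite set,
and Fatou's lemma applies to the whole sum. -/
theorem HasBoundedRows.logDomain_limit (hw : HasBoundedRows w W) {h₀ : ℝ} (hh : ∀ x, h₀ ≤ h x)
    {p q : ℕ → Lattice d → ℝ} {p' q' : Lattice d → ℝ} {R : ℝ}
    (hfin : {x | h x ≤ Real.log R}.Finite)
    (hp : ∀ n, LogDomain h (p n)) (hq : ∀ n, LogDomain h (q n)) (hp0 : ∀ n, p n ≠ 0)
    (hsub : ∀ n x y, 0 ≤ (p n x - p n y) * (q n x - q n y))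
    (he : ∀ n, nehariForm w h (p n) + energyForm w (p n) (q n) = 0)
    (hpR : ∀ n x, p n x ^ 2 ≤ R) (hqR : ∀ n x, q n x ^ 2 ≤ R)
    (hpt : ∀ x, Tendsto (fun n => p n x) atTop (nhds (p' x)))
    (hqt : ∀ x, Tendsto (fun n => q n x) atTop (nhds (q' x)))
    (hp2 : Summable fun x => p' x ^ 2) (hph : Summable fun x => h x * p' x ^ 2)
    (hq2 : Summable fun x => q' x ^ 2) :
    LogDomain h p' ∧ p' ≠ 0 ∧ nehariForm w h p' + energyForm w p' q' ≤ 0 := by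
  have hcont : Continuous fun t : ℝ => t ^ 2 * Real.log (t ^ 2) :=
    Real.continuous_mul_log.comp (continuous_pow 2)
  have hlog : ∀ n x, p n x ^ 2 * Real.log (p n x ^ 2) ≤ Real.log R * p n x ^ 2 := by
    intro n x
    by_cases hx : p n x = 0
    · simp [hx]
    · rw [mul_comm]
      exact mul_le_mul_of_nonneg_right (Real.log_le_log (by positivity) (hpR n x)) (sq_nonneg _)
  have hFatou := summable_and_tsum_le_of_tendsto (c := fun _ => 0) (c' := 0) hfin.toFinset
    (f := fun n x => gradForm w (p n) (p n) x + gradForm w (p n) (q n) x +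
      h x * p n x ^ 2 - p n x ^ 2 * Real.log (p n x ^ 2))
    (g := fun x => gradForm w p' p' x + gradForm w p' q' x +
      h x * p' x ^ 2 - p' x ^ 2 * Real.log (p' x ^ 2))
    (fun n x hx => ?_) (fun n => ?_) (fun n => ?_) tendsto_const_nhds (fun x => ?_)
  rotate_left
  · have hx' : Real.log R < h x := by simpa using hx
    have h1 := hw.gradForm_self_nonneg (p n) x
    have h2 := hw.gradForm_nonneg (hsub n) x
    have h3 := hlog n x
    nlinarith [sq_nonneg (p n x)]
  · exact (((hw.summable_gradForm (hp n).sq (hp n).sq).add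
      (hw.summable_gradForm (hp n).sq (hq n).sq)).add (hp n).potential).sub (hp n).entropy
  · rw [(((hw.summable_gradForm (hp n).sq (hp n).sq).add
      (hw.summable_gradForm (hp n).sq (hq n).sq)).add (hp n).potential).tsum_sub (hp n).entropy,
      ((hw.summable_gradForm (hp n).sq (hp n).sq).add
      (hw.summable_gradForm (hp n).sq (hq n).sq)).tsum_add (hp n).potential,
      (hw.summable_gradForm (hp n).sq (hp n).sq).tsum_add
      (hw.summable_gradForm (hp n).sq (hq n).sq)]
    have := he n
    simp only [nehariForm, energyForm] at this
    linarith
  · have hB : ∀ n x, |p n x| ≤ √R := fun n x => Real.abs_le_sqrt (hpR n x)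
    have hB' : ∀ n x, |q n x| ≤ √R := fun n x => Real.abs_le_sqrt (hqR n x)
    exact (((hw.tendsto_gradForm hB hB hpt hpt x).add (hw.tendsto_gradForm hB hB' hpt hqt x)).add
      (((hpt x).pow 2).const_mul _)).sub ((hcont.tendsto _).comp (hpt x))
  · obtain ⟨hsum, hle⟩ := hFatou
    have hs1 := hw.summable_gradForm hp2 hp2
    have hs2 := hw.summable_gradForm hp2 hq2
    -- The entropy of the limit converges because it is the difference of convergent series and the
    -- Fatou limit.
    have hent : Summable fun x => p' x ^ 2 * Real.log (p' x ^ 2) :=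
      (((hs1.add hs2).add hph).sub hsum).congr fun x => by ring
    refine ⟨⟨hp2, hph, hent⟩, ?_, ?_⟩
    -- For each `n` some vertex has `h x ≤ log (p n x ^ 2) ≤ log R`. It lies in the fixed finite set
    -- and carries mass at least `exp h₀`, which excludes a zero limit.
    · rintro rfl
      have hlim : Tendsto (fun n => ∑ x ∈ hfin.toFinset, p n x ^ 2) atTop (nhds 0) := by
        have := tendsto_finsetSum hfin.toFinset fun x _ => (hpt x).pow 2
        simpa using this
      refine (Real.exp_pos h₀).not_ge (ge_of_tendsto' hlim fun n => ?_)
      obtain ⟨x, hx0, hx⟩ := hw.exists_potential_le_log (hp n) (hp0 n) (hsub n) (he n)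
      have hxF : x ∈ hfin.toFinset := by
        simpa using hx.trans (Real.log_le_log (by positivity) (hpR n x))
      exact ((Real.le_log_iff_exp_le (by positivity)).1 ((hh x).trans hx)).trans
        (Finset.single_le_sum (f := fun x => p n x ^ 2) (fun _ _ => sq_nonneg _) hxF)
    · rw [((hs1.add hs2).add hph).tsum_sub hent, (hs1.add hs2).tsum_add hph,
        hs1.tsum_add hs2] at hle
      simp only [nehariForm, energyForm]
      linarith

theorem exists_pointwise_tendsto_subseq {ι : Type*} [Countable ι] {u : ℕ → ι → ℝ} {B : ℝ}
    (hu : ∀ n x, |u n x| ≤ B) : ∃ (v : ι → ℝ) (φ : ℕ → ℕ), StrictMono φ ∧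
      ∀ x, Tendsto (fun n => u (φ n) x) atTop (nhds (v x)) := by
  have hc : IsCompact (Set.univ.pi fun _ : ι => Set.Icc (-B) B) :=
    isCompact_univ_pi fun _ => isCompact_Icc
  obtain ⟨v, -, φ, hφ, ht⟩ := hc.tendsto_subseq (x := u) fun n x _ => abs_le.1 (hu n x)
  exact ⟨v, φ, hφ, fun x => (tendsto_pi_nhds.1 ht) x⟩

/-- In `⟨J'(u), u⟩ = 0` the Dirichlet form is dropped and the entropy is bounded using `u² ≤ R`. The
uniform bound gives the limit a finite potential energy. -/
theorem HasBoundedRows.tsum_potential_le (hw : HasBoundedRows w W) {u : Lattice d → ℝ} {R : ℝ}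
    (hR : 1 ≤ R) (hu : u ∈ nehariSC w h) (huR : sqSum u ≤ R) :
    ∑' x, (h x + 1) * u x ^ 2 ≤ Real.log R * R + R := by
  have hL := hw.mem_domJ_iff.1 hu.1
  have hs := hw.signPair_of_mem hu
  obtain ⟨h1, h2⟩ := hw.nehari_eqs hu
  have h3 := hw.nehariForm_add hs.left hs.right hs.disjoint
  rw [← eq_uPlus_add_uMinus] at h3
  have h4 : nehariForm w h u = 0 := by linarith
  have h5 : 0 ≤ energyForm w u u := tsum_nonneg fun x => hw.gradForm_self_nonneg u x
  have h6 : ∑' x, u x ^ 2 * Real.log (u x ^ 2) ≤ Real.log R * sqSum u := by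
    rw [sqSum, ← tsum_mul_left]
    refine Summable.tsum_le_tsum (fun x => ?_) hL.entropy (hL.sq.mul_left _)
    by_cases hx : u x = 0
    · simp [hx]
    · rw [mul_comm]
      refine mul_le_mul_of_nonneg_right (Real.log_le_log (by positivity) ?_) (sq_nonneg _)
      exact (hL.sq.le_tsum x fun _ _ => sq_nonneg _).trans huR
  have h7 : ∑' x, (h x + 1) * u x ^ 2 = ∑' x, h x * u x ^ 2 + sqSum u := by
    rw [sqSum, ← hL.potential.tsum_add hL.sq]
    exact tsum_congr fun x => by ring
  have h8 : Real.log R * sqSum u ≤ Real.log R * R :=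
    mul_le_mul_of_nonneg_left huR (Real.log_nonneg hR)
  rw [nehariForm] at h4
  linarith

theorem HasBoundedRows.sqSum_eq_of_mem (hw : HasBoundedRows w W) {u : Lattice d → ℝ}
    (hu : u ∈ nehariSC w h) : sqSum u = 2 * energyJ w h u := by
  have hs := hw.signPair_of_mem hu
  have h1 := sqSum_add hs.left hs.right hs.disjoint
  rw [← eq_uPlus_add_uMinus] at h1
  rw [h1, hw.energyJ_of_mem hu]
  ring

theorem HasBoundedRows.bddBelow_energyJ (hw : HasBoundedRows w W) {h₀ : ℝ}
    (hh : ∀ x, h₀ ≤ h x) : BddBelow (energyJ w h '' nehariSC w h) := by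
  refine ⟨1 / 2 * Real.exp h₀, ?_⟩
  rintro _ ⟨u, hu, rfl⟩
  exact hw.exp_le_energyJ hh hu

theorem HasBoundedRows.levelSC_le (hw : HasBoundedRows w W) {h₀ : ℝ} (hh : ∀ x, h₀ ≤ h x)
    {u : Lattice d → ℝ} (hu : u ∈ nehariSC w h) : levelSC w h ≤ energyJ w h u :=
  csInf_le (hw.bddBelow_energyJ hh) ⟨u, hu, rfl⟩

theorem HasBoundedRows.exists_minimizer (hw : HasBoundedRows w W) (hd : 1 ≤ d) {h₀ : ℝ}
    (hh0 : -1 < h₀) (hh : ∀ x, h₀ ≤ h x) (hfin : ∀ a, {x | h x ≤ a}.Finite) :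
    ∃ u ∈ nehariSC w h, energyJ w h u = levelSC w h := by
  have hne : (energyJ w h '' nehariSC w h).Nonempty := (nehariSC_nonempty hw hd).image _
  obtain ⟨e, hanti, htend, hmem⟩ :=
    exists_seq_tendsto_sInf hne (hw.bddBelow_energyJ hh)
  choose u₀ hu₀ he₀ using hmem
  -- On `M` the squared norm is twice the energy, so `2 * e 0` bounds the whole decreasing sequence;
  -- the `1` ensures `log R ≥ 0`.
  set R : ℝ := max 1 (2 * e 0) with hRdef
  have hR : 1 ≤ R := le_max_left _ _
  have hsq₀ : ∀ n, sqSum (u₀ n) = 2 * e n := fun n => by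
    rw [hw.sqSum_eq_of_mem (hu₀ n), he₀]
  have hsqR₀ : ∀ n, sqSum (u₀ n) ≤ R := fun n => by
    rw [hsq₀]
    exact (mul_le_mul_of_nonneg_left (hanti (Nat.zero_le n)) (by norm_num)).trans
      (le_max_right _ _)
  have hL₀ : ∀ n, LogDomain h (u₀ n) := fun n => hw.mem_domJ_iff.1 (hu₀ n).1
  have hpt₀ : ∀ n x, u₀ n x ^ 2 ≤ R := fun n x =>
    ((hL₀ n).sq.le_tsum x fun _ _ => sq_nonneg _).trans (hsqR₀ n)
  obtain ⟨v, φ, hφ, hv⟩ := exists_pointwise_tendsto_subseq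
    (fun n x => Real.abs_le_sqrt (hpt₀ n x))
  set u : ℕ → Lattice d → ℝ := fun n => u₀ (φ n) with hu
  obtain ⟨hv2, hvm⟩ := summable_and_tsum_le_of_tendsto (f := fun n x => u n x ^ 2)
    (g := fun x => v x ^ 2) (c := fun n => 2 * e (φ n)) (c' := 2 * levelSC w h) ∅
    (fun _ _ _ => sq_nonneg _) (fun n => (hL₀ (φ n)).sq) (fun n => (hsq₀ (φ n)).le)
    ((htend.comp hφ.tendsto_atTop).const_mul 2) (fun x => (hv x).pow 2)
  obtain ⟨hv3, -⟩ := summable_and_tsum_le_of_tendsto (f := fun n x => (h x + 1) * u n x ^ 2)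
    (g := fun x => (h x + 1) * v x ^ 2) (c := fun _ => Real.log R * R + R) ∅
    (fun _ x _ => mul_nonneg (by linarith [hh x]) (sq_nonneg _))
    (fun n => ((hL₀ (φ n)).potential.add (hL₀ (φ n)).sq).congr fun x => by ring)
    (fun n => hw.tsum_potential_le hR (hu₀ (φ n)) (hsqR₀ (φ n))) tendsto_const_nhds
    (fun x => ((hv x).pow 2).const_mul _)
  have hvh : Summable fun x => h x * v x ^ 2 := (hv3.sub hv2).congr fun x => by ring
  have hs : ∀ n, SignPair h (uPlus (u n)) (uMinus (u n)) := fun n => hw.signPair_of_mem (hu₀ (φ n))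
  have hpt : ∀ x, Tendsto (fun n => uPlus (u n) x) atTop (nhds (uPlus v x)) := fun x =>
    (hv x).max tendsto_const_nhds
  have hmt : ∀ x, Tendsto (fun n => uMinus (u n) x) atTop (nhds (uMinus v x)) := fun x =>
    (hv x).min tendsto_const_nhds
  have hle : ∀ (f : Lattice d → ℝ) (x : Lattice d), (uPlus f x) ^ 2 ≤ f x ^ 2 ∧
      (uMinus f x) ^ 2 ≤ f x ^ 2 := by
    intro f x
    unfold uPlus uMinus
    rcases le_total (f x) 0 with hx | hx
    · simp [hx, sq_nonneg]
    · simp [hx, sq_nonneg (f x)]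
  have hp2 : Summable fun x => uPlus v x ^ 2 :=
    Summable.of_nonneg_of_le (fun x => sq_nonneg _) (fun x => (hle v x).1) hv2
  have hm2 : Summable fun x => uMinus v x ^ 2 :=
    Summable.of_nonneg_of_le (fun x => sq_nonneg _) (fun x => (hle v x).2) hv2
  have hph : Summable fun x => h x * uPlus v x ^ 2 :=
    ((Summable.of_nonneg_of_le (fun x => mul_nonneg (by linarith [hh x]) (sq_nonneg _))
      (fun x => mul_le_mul_of_nonneg_left (hle v x).1 (by linarith [hh x])) hv3).sub hp2).congr
      fun x => by ring
  have hmh : Summable fun x => h x * uMinus v x ^ 2 :=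
    ((Summable.of_nonneg_of_le (fun x => mul_nonneg (by linarith [hh x]) (sq_nonneg _))
      (fun x => mul_le_mul_of_nonneg_left (hle v x).2 (by linarith [hh x])) hv3).sub hm2).congr
      fun x => by ring
  have hpR : ∀ n x, uPlus (u n) x ^ 2 ≤ R := fun n x => (hle (u n) x).1.trans (hpt₀ (φ n) x)
  have hmR : ∀ n x, uMinus (u n) x ^ 2 ≤ R := fun n x => (hle (u n) x).2.trans (hpt₀ (φ n) x)
  obtain ⟨hpL, hp0, hpe⟩ := hw.logDomain_limit hh (hfin _) (fun n => (hs n).left)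
    (fun n => (hs n).right) (fun n => (hs n).left_ne) (fun n => (hs n).sub_mul_sub_nonneg)
    (fun n => (hw.nehari_eqs (hu₀ (φ n))).1) hpR hmR hpt hmt hp2 hph hm2
  obtain ⟨hmL, hm0, hme⟩ := hw.logDomain_limit hh (hfin _) (fun n => (hs n).right)
    (fun n => (hs n).left) (fun n => (hs n).right_ne)
    (fun n x y => by rw [mul_comm]; exact (hs n).sub_mul_sub_nonneg x y)
    (fun n => by
      rw [energyForm_comm (uMinus (u n))]
      exact (hw.nehari_eqs (hu₀ (φ n))).2) hmR hpR hmt hpt hm2 hmh hp2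
  rw [energyForm_comm (uMinus v)] at hme
  have hsv : SignPair h (uPlus v) (uMinus v) :=
    ⟨hpL, hmL, uPlus_nonneg v, uMinus_nonpos v, uPlus_mul_uMinus v, hp0, hm0⟩
  have hsum : sqSum (uPlus v) + sqSum (uMinus v) ≤ 2 * levelSC w h := by
    rw [← sqSum_add hpL hmL hsv.disjoint, ← eq_uPlus_add_uMinus]
    exact hvm
  obtain ⟨a, b, ha, hb, hab⟩ := hsv.exists_smul_mem_nehariSC hw
  obtain ⟨e1, e2⟩ := (hsv.smul_mem_nehariSC_iff hw ha hb).1 hab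
  have hJ := hw.levelSC_le hh hab
  rw [hsv.energyJ_of_smul_mem hw ha hb hab] at hJ
  have hP := hsv.sqSum_left_pos
  have hN := hsv.sqSum_right_pos
  have hK := hsv.energyForm_nonneg hw
  -- The inequality for the larger factor bounds the smaller one too.
  have hone : a ≤ 1 ∧ b ≤ 1 := by
    rcases le_total b a with hba | hba
    · have := nehari_scaling_le_one hP hK ha hpe hba e1
      exact ⟨this, hba.trans this⟩
    · have := nehari_scaling_le_one hN hK hb hme hba e2
      exact ⟨hba.trans this, this⟩
  have ha1 : a ^ 2 ≤ 1 := pow_le_one₀ ha.le hone.1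
  have hb1 : b ^ 2 ≤ 1 := pow_le_one₀ hb.le hone.2
  have ha2 : a = 1 := by
    have : a ^ 2 = 1 := le_antisymm ha1 (by nlinarith)
    exact (pow_eq_one_iff_of_nonneg ha.le two_ne_zero).1 this
  have hb2 : b = 1 := by
    have : b ^ 2 = 1 := le_antisymm hb1 (by nlinarith)
    exact (pow_eq_one_iff_of_nonneg hb.le two_ne_zero).1 this
  subst ha2 hb2
  have hvM : v ∈ nehariSC w h := by
    simp only [one_mul] at hab
    rwa [← eq_uPlus_add_uMinus] at hab
  refine ⟨v, hvM, le_antisymm ?_ (hw.levelSC_le hh hvM)⟩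
  rw [hw.energyJ_of_mem hvM]
  linarith

end Minimizer

/-! ### Real-variable estimates for the first variation. -/

section RealAnalysis

/-- The formula holds at `τ = 0` as well, with `log 0 = 0`: the difference quotient there is `2 t
log |t|`, which tends to `0`. Vertices where `u` vanishes therefore need no separate variation. -/
theorem hasDerivAt_sq_mul_log_sq (τ : ℝ) :
    HasDerivAt (fun t : ℝ => t ^ 2 * Real.log (t ^ 2)) (2 * τ * Real.log (τ ^ 2) + 2 * τ) τ := by
  by_cases hτ : τ = 0
  · subst hτ
    rw [hasDerivAt_iff_tendsto_slope]
    have h1 : Tendsto (fun t : ℝ => 2 * (t * Real.log t)) (nhdsWithin 0 {0}ᶜ) (nhds 0) := by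
      have := (Real.continuous_mul_log.const_mul 2).tendsto 0
      simp only [zero_mul, mul_zero] at this
      exact this.mono_left nhdsWithin_le_nhds
    simp only [mul_zero, zero_mul, add_zero]
    refine h1.congr' ?_
    filter_upwards [self_mem_nhdsWithin] with t ht
    have ht' : t ≠ 0 := ht
    rw [slope_def_field, Real.log_pow]
    field_simp
    simp
    ring
  · have h1 := (Real.hasDerivAt_mul_log (x := τ ^ 2) (by positivity)).comp τ (hasDerivAt_pow 2 τ)
    refine h1.congr_deriv ?_
    push_cast
    ring

/-- An element of `M` maximizes `J` among its positive scalings. With `A = B = -K` the coupling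
contributes `-K (a - b)²`, and `c² - c² log c² ≤ 1` handles the rest. -/
theorem nehari_value_le {A B K P N a b : ℝ} (hP : 0 < P) (hN : 0 < N) (hK : 0 ≤ K) (ha : 0 < a)
    (hb : 0 < b) (hA : A + K = 0) (hB : B + K = 0) :
    a ^ 2 * (A - Real.log (a ^ 2) * P + P) + b ^ 2 * (B - Real.log (b ^ 2) * N + N) +
      2 * (a * b) * K ≤ P + N := by
  have key : ∀ c : ℝ, 0 < c → c ^ 2 - 1 ≤ c ^ 2 * Real.log (c ^ 2) := fun c hc => by
    have h1 := mul_le_mul_of_nonneg_left (Real.one_sub_inv_le_log_of_pos (x := c ^ 2)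
      (by positivity)) (sq_nonneg c)
    rwa [mul_sub, mul_one, mul_inv_cancel₀ (by positivity)] at h1
  have h1 := mul_le_mul_of_nonneg_right (key a ha) hP.le
  have h2 := mul_le_mul_of_nonneg_right (key b hb) hN.le
  have h3 := mul_nonneg hK (sq_nonneg (a - b))
  obtain rfl : A = -K := by linarith
  obtain rfl : B = -K := by linarith
  nlinarith

theorem tendsto_of_tendsto_sub_div {t f : ℕ → ℝ} {l f' : ℝ} (ht : Tendsto t atTop (nhds 0))
    (ht0 : ∀ n, t n ≠ 0) (hf : Tendsto (fun n => (f n - l) / t n) atTop (nhds f')) :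
    Tendsto f atTop (nhds l) := by
  have h1 := (hf.mul ht).add_const l
  rw [mul_zero, zero_add] at h1
  refine h1.congr fun n => ?_
  rw [div_mul_cancel₀ _ (ht0 n), sub_add_cancel]

/-- First variation of the maximum over positive scalings of `p` and `q`. -/
theorem exists_first_variation {A B K P N : ℝ} (hP : 0 < P) (hN : 0 < N) (hK : 0 ≤ K)
    (hA : A + K = 0) (hB : B + K = 0) {t As Ks Ps : ℕ → ℝ} {A' K' P' : ℝ}
    (ht : Tendsto t atTop (nhds 0)) (ht0 : ∀ n, t n ≠ 0)
    (hA' : Tendsto (fun n => (As n - A) / t n) atTop (nhds A'))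
    (hK' : Tendsto (fun n => (Ks n - K) / t n) atTop (nhds K'))
    (hP' : Tendsto (fun n => (Ps n - P) / t n) atTop (nhds P'))
    (hPs : ∀ n, 0 < Ps n) (hKs : ∀ n, 0 ≤ Ks n)
    (hmin : ∀ n a b, 0 < a → 0 < b →
      a * (As n - Real.log (a ^ 2) * Ps n) + b * Ks n = 0 →
      b * (B - Real.log (b ^ 2) * N) + a * Ks n = 0 →
      P + N ≤ a ^ 2 * (As n - Real.log (a ^ 2) * Ps n + Ps n) +
        b ^ 2 * (B - Real.log (b ^ 2) * N + N) + 2 * (a * b) * Ks n) :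
    ∃ ρ : ℕ → ℝ, (∀ n, 0 ≤ ρ n) ∧
      Tendsto (fun n => ρ n / t n) atTop (nhds (A' + P' + 2 * K')) := by
  choose θ a b hθ ha hb e1 e2 using fun n =>
    exists_nehari_scaling (A := As n) (B := B) (hPs n) hN (hKs n)
  have ha0 : ∀ n, 0 < a n := fun n => ha n ▸ Real.exp_pos _
  have hb0 : ∀ n, 0 < b n := fun n => hb n ▸ mul_pos (ha0 n) (Real.exp_pos _)
  have hAl := tendsto_of_tendsto_sub_div ht ht0 hA'
  have hKl := tendsto_of_tendsto_sub_div ht ht0 hK'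
  have hPl := tendsto_of_tendsto_sub_div ht ht0 hP'
  -- The bound on `θ` tends to `0` because both Nehari defects vanish in the limit; then `a` and `b`
  -- tend to `1`.
  have hθl : Tendsto θ atTop (nhds 0) := by
    refine squeeze_zero_norm hθ ?_
    have h1 := (((hAl.add hKl).div hPl hP.ne').sub ((hKl.const_add B).div_const N)).abs
    rw [hA, hB, zero_div, zero_div, sub_zero, abs_zero] at h1
    exact h1
  have hexp : Tendsto (fun n => Real.exp (θ n)) atTop (nhds 1) := by
    have := (Real.continuous_exp.tendsto 0).comp hθl
    rwa [Real.exp_zero] at this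
  have hal : Tendsto a atTop (nhds 1) := by
    have h1 := (Real.continuous_exp.tendsto _).comp
      (((hAl.add (hexp.mul hKl)).div hPl hP.ne').div_const 2)
    rw [one_mul, hA, zero_div, zero_div, Real.exp_zero] at h1
    exact h1.congr fun n => (ha n).symm
  have hbl : Tendsto b atTop (nhds 1) := by
    have h1 := hal.mul hexp
    rw [one_mul] at h1
    exact h1.congr fun n => (hb n).symm
  have hlog : Tendsto (fun n => Real.log (a n ^ 2)) atTop (nhds 0) := by
    have h1 := (hal.pow 2).log (by norm_num)
    rwa [one_pow, Real.log_one] at h1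
  -- This is twice the perturbed energy minus the unperturbed one at the same factors `a n`, `b n`,
  -- so the derivatives of the factors never enter.
  refine ⟨fun n => a n ^ 2 * ((As n - A) - Real.log (a n ^ 2) * (Ps n - P) + (Ps n - P)) +
    2 * (a n * b n) * (Ks n - K), fun n => ?_, ?_⟩
  · have h1 := hmin n (a n) (b n) (ha0 n) (hb0 n) (e1 n) (e2 n)
    have h2 := nehari_value_le hP hN hK (ha0 n) (hb0 n) hA hB
    linarith
  · have h1 := ((hal.pow 2).mul ((hA'.sub (hlog.mul hP')).add hP')).add
      (((hal.mul hbl).const_mul 2).mul hK')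
    have h2 : (1 : ℝ) ^ 2 * (A' - 0 * P' + P') + 2 * (1 * 1) * K' = A' + P' + 2 * K' := by ring
    rw [h2] at h1
    refine h1.congr fun n => ?_
    ring

end RealAnalysis

/-! ### Minimizers satisfy the equation at every vertex. -/

section CriticalPoint

variable {d : ℕ} {w : Lattice d → Lattice d → ℝ} {W : ℝ} {h : Lattice d → ℝ}

theorem tsum_eq_add_of_eq_off {ι : Type*} {f g : ι → ℝ} (hf : Summable f) (z : ι)
    (hg : ∀ x, x ≠ z → g x = f x) : ∑' x, g x = ∑' x, f x + (g z - f z) := by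
  classical
  have h1 : g = Function.update f z (g z) := by
    ext x
    by_cases hx : x = z
    · subst hx
      simp
    · simp [hx, hg x hx]
  rw [h1, (hf.hasSum.update z (g z)).tsum_eq]
  simp only [Function.update_self]
  ring

/-- The function `p + t δ_z`. -/
noncomputable def bump (p : Lattice d → ℝ) (z : Lattice d) (t : ℝ) : Lattice d → ℝ :=
  fun x => 1 * p x + t * (Pi.single z 1 : Lattice d → ℝ) x

theorem bump_self (p : Lattice d → ℝ) (z : Lattice d) (t : ℝ) : bump p z t z = p z + t := by
  simp [bump]

theorem bump_of_ne (p : Lattice d → ℝ) {z x : Lattice d} (t : ℝ) (hx : x ≠ z) :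
    bump p z t x = p x := by
  simp [bump, hx]

theorem LogDomain.bump {p : Lattice d → ℝ} (hp : LogDomain h p) (z : Lattice d) (t : ℝ) :
    LogDomain h (bump p z t) :=
  hp.congr_off z fun _ hx => bump_of_ne p t hx

theorem sqSum_bump {p : Lattice d → ℝ} (hp : LogDomain h p) (z : Lattice d) (t : ℝ) :
    sqSum (bump p z t) = sqSum p + (2 * t * p z + t ^ 2) := by
  rw [sqSum, tsum_eq_add_of_eq_off hp.sq z fun x hx => by rw [bump_of_ne p t hx], bump_self, sqSum]
  ring

theorem HasBoundedRows.energyForm_bump (hw : HasBoundedRows w W) {p q : Lattice d → ℝ}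
    (hp : LogDomain h p) (hq : LogDomain h q) (z : Lattice d) (t : ℝ) :
    energyForm w (bump p z t) q = energyForm w p q + t * fracLaplacian w q z := by
  unfold bump
  rw [hw.energyForm_linear hp.sq (summable_sq_single z) hq.sq, energyForm_comm (Pi.single z 1),
    hw.energyForm_single hq.sq, one_mul]

theorem HasBoundedRows.fracLaplacian_add (hw : HasBoundedRows w W) {p q : Lattice d → ℝ}
    (hp : Summable fun x => p x ^ 2) (hq : Summable fun x => q x ^ 2) (z : Lattice d) :
    fracLaplacian w (fun x => p x + q x) z = fracLaplacian w p z + fracLaplacian w q z := by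
  simp only [fracLaplacian_eq]
  rw [← (hw.summable_laplacian hp z).tsum_add (hw.summable_laplacian hq z)]
  exact tsum_congr fun y => by ring

theorem HasBoundedRows.nehariForm_bump (hw : HasBoundedRows w W) {p : Lattice d → ℝ}
    (hp : LogDomain h p) (z : Lattice d) (t : ℝ) :
    nehariForm w h (bump p z t) = nehariForm w h p + 2 * t * fracLaplacian w p z +
      t ^ 2 * fracLaplacian w (Pi.single z 1) z + h z * (2 * t * p z + t ^ 2) -
      ((p z + t) ^ 2 * Real.log ((p z + t) ^ 2) - p z ^ 2 * Real.log (p z ^ 2)) := by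
  have hδ : LogDomain h (Pi.single z 1 : Lattice d → ℝ) :=
    LogDomain.zero.congr_off z fun x hx => by simp [hx]
  have hL : fracLaplacian w (bump p z t) z =
      fracLaplacian w p z + t * fracLaplacian w (Pi.single z 1) z := by
    rw [← hw.energyForm_single (hp.bump z t).sq, hw.energyForm_bump hp hδ,
      hw.energyForm_single hp.sq]
  have hE : energyForm w (bump p z t) (bump p z t) = energyForm w p p +
      2 * t * fracLaplacian w p z + t ^ 2 * fracLaplacian w (Pi.single z 1) z := by
    rw [hw.energyForm_bump hp (hp.bump z t), hL, energyForm_comm, hw.energyForm_bump hp hp]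
    ring
  have hP := tsum_eq_add_of_eq_off hp.potential z (g := fun x => h x * bump p z t x ^ 2)
    fun x hx => by rw [bump_of_ne p t hx]
  have hN := tsum_eq_add_of_eq_off hp.entropy z
    (g := fun x => bump p z t x ^ 2 * Real.log (bump p z t x ^ 2))
    fun x hx => by rw [bump_of_ne p t hx]
  simp only [bump_self] at hP hN
  rw [nehariForm, nehariForm, hE, hP, hN]
  ring

/-- Perturbing only at a vertex outside the support of `q`, and keeping the value there positive,
preserves the sign structure. -/
theorem SignPair.bump {p q : Lattice d → ℝ} (hpq : SignPair h p q) {z : Lattice d} {t : ℝ}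
    (hq : q z = 0) (ht : 0 < p z + t) : SignPair h (bump p z t) q where
  left := hpq.left.bump z t
  right := hpq.right
  nonneg x := by
    by_cases hx : x = z
    · rw [hx, bump_self]
      exact ht.le
    · rw [bump_of_ne p t hx]
      exact hpq.nonneg x
  nonpos := hpq.nonpos
  disjoint x := by
    by_cases hx : x = z
    · rw [hx, hq, mul_zero]
    · rw [bump_of_ne p t hx]
      exact hpq.disjoint x
  left_ne := Function.ne_iff.2 ⟨z, by rw [bump_self]; exact ht.ne'⟩
  right_ne := hpq.right_ne

/-- The defect of the equation at a vertex. -/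
noncomputable def residual (w : Lattice d → Lattice d → ℝ) (h u : Lattice d → ℝ)
    (z : Lattice d) : ℝ :=
  fracLaplacian w u z + h z * u z - u z * Real.log (u z ^ 2)

theorem HasBoundedRows.exists_residual_limit (hw : HasBoundedRows w W) {h₀ : ℝ}
    (hh : ∀ x, h₀ ≤ h x) {u : Lattice d → ℝ} (hu : u ∈ nehariSC w h)
    (hum : energyJ w h u = levelSC w h) {z : Lattice d} (hz : 0 ≤ u z) {t : ℕ → ℝ}
    (ht : Tendsto t atTop (nhds 0)) (ht0 : ∀ n, t n ≠ 0) (hzt : ∀ n, 0 < u z + t n) :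
    ∃ ρ : ℕ → ℝ, (∀ n, 0 ≤ ρ n) ∧
      Tendsto (fun n => ρ n / t n) atTop (nhds (2 * residual w h u z)) := by
  have hs := hw.signPair_of_mem hu
  have hpz : uPlus u z = u z := max_eq_left hz
  have hqz : uMinus u z = 0 := min_eq_right hz
  obtain ⟨e1, e2⟩ := hw.nehari_eqs hu
  rw [hw.energyJ_of_mem hu] at hum
  have hsb : ∀ n, SignPair h (bump (uPlus u) z (t n)) (uMinus u) := fun n =>
    hs.bump hqz (hpz ▸ hzt n)
  have htw : Tendsto t atTop (nhdsWithin 0 {0}ᶜ) :=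
    tendsto_nhdsWithin_iff.2 ⟨ht, Eventually.of_forall ht0⟩
  have hslope := (hasDerivAt_sq_mul_log_sq (u z)).tendsto_slope_zero.comp htw
  have hA' : Tendsto (fun n => (nehariForm w h (bump (uPlus u) z (t n)) -
      nehariForm w h (uPlus u)) / t n) atTop (nhds (2 * fracLaplacian w (uPlus u) z +
        0 * fracLaplacian w (Pi.single z 1) z + h z * (2 * u z + 0) -
        (2 * u z * Real.log (u z ^ 2) + 2 * u z))) := by
    have hlin := ((ht.mul_const (fracLaplacian w (Pi.single z 1) z)).const_add
      (2 * fracLaplacian w (uPlus u) z)).add ((ht.const_add (2 * u z)).const_mul (h z))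
    refine (hlin.sub hslope).congr fun n => ?_
    rw [hw.nehariForm_bump hs.left, hpz, Function.comp_apply, smul_eq_mul]
    field_simp [ht0 n]
    ring
  have hK' : Tendsto (fun n => (energyForm w (bump (uPlus u) z (t n)) (uMinus u) -
      energyForm w (uPlus u) (uMinus u)) / t n) atTop (nhds (fracLaplacian w (uMinus u) z)) := by
    refine tendsto_const_nhds.congr fun n => ?_
    rw [hw.energyForm_bump hs.left hs.right, add_sub_cancel_left, mul_div_cancel_left₀ _ (ht0 n)]
  have hP' : Tendsto (fun n => (sqSum (bump (uPlus u) z (t n)) - sqSum (uPlus u)) / t n) atTop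
      (nhds (2 * u z + 0)) := by
    refine (ht.const_add (2 * u z)).congr fun n => ?_
    rw [sqSum_bump hs.left, hpz]
    field_simp [ht0 n]
    ring
  obtain ⟨ρ, hρ, hlim⟩ := exists_first_variation hs.sqSum_left_pos hs.sqSum_right_pos
    (hs.energyForm_nonneg hw) e1 e2 ht ht0 hA' hK' hP'
    (fun n => (hsb n).sqSum_left_pos) (fun n => (hsb n).energyForm_nonneg hw)
    fun n a b ha hb h1 h2 => by
      have hm := ((hsb n).smul_mem_nehariSC_iff hw ha hb).2 ⟨h1, h2⟩
      have hle := hw.levelSC_le hh hm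
      rw [← hum, (hsb n).energyJ_smul hw ha hb] at hle
      linarith
  refine ⟨ρ, hρ, ?_⟩
  have hL := hw.fracLaplacian_add hs.left.sq hs.right.sq z
  rw [← eq_uPlus_add_uMinus] at hL
  -- The term `-2 u z` from differentiating the entropy cancels the derivative `2 u z` of the
  -- squared norm.
  convert hlim using 2
  rw [residual, hL]
  ring

/-- Positive increments are always admissible where `u z ≥ 0`, including at zeros of `u`. -/
theorem HasBoundedRows.residual_nonneg (hw : HasBoundedRows w W) {h₀ : ℝ}
    (hh : ∀ x, h₀ ≤ h x) {u : Lattice d → ℝ} (hu : u ∈ nehariSC w h)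
    (hum : energyJ w h u = levelSC w h) {z : Lattice d} (hz : 0 ≤ u z) :
    0 ≤ residual w h u z := by
  obtain ⟨ρ, hρ, hlim⟩ := hw.exists_residual_limit hh hu hum hz
    (tendsto_one_div_add_atTop_nhds_zero_nat (𝕜 := ℝ)) (fun n => by positivity)
    (fun n => by positivity)
  linarith [ge_of_tendsto' hlim fun n => div_nonneg (hρ n) (by positivity)]

theorem HasBoundedRows.residual_eq_zero_of_pos (hw : HasBoundedRows w W) {h₀ : ℝ}
    (hh : ∀ x, h₀ ≤ h x) {u : Lattice d → ℝ} (hu : u ∈ nehariSC w h)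
    (hum : energyJ w h u = levelSC w h) {z : Lattice d} (hz : 0 < u z) :
    residual w h u z = 0 := by
  refine le_antisymm ?_ (hw.residual_nonneg hh hu hum hz.le)
  -- Negative increments of size at most `u z / 2` keep the perturbed value positive and give the
  -- reverse inequality.
  have ht : Tendsto (fun n : ℕ => -(u z / 2) * (1 / ((n : ℝ) + 1))) atTop (nhds 0) := by
    simpa using (tendsto_one_div_add_atTop_nhds_zero_nat (𝕜 := ℝ)).const_mul (-(u z / 2))
  have hpos : ∀ n : ℕ, 0 < u z / 2 * (1 / ((n : ℝ) + 1)) := fun n => by positivity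
  obtain ⟨ρ, hρ, hlim⟩ := hw.exists_residual_limit hh hu hum hz.le ht
    (fun n => by
      rw [neg_mul]
      exact neg_ne_zero.2 (hpos n).ne')
    (fun n => by
      have h1 : 1 / ((n : ℝ) + 1) ≤ 1 := by
        rw [div_le_one (by positivity)]
        linarith [(Nat.cast_nonneg n : (0 : ℝ) ≤ n)]
      nlinarith)
  have := le_of_tendsto' hlim fun n =>
    div_nonpos_of_nonneg_of_nonpos (hρ n) (by linarith [hpos n])
  linarith

theorem HasBoundedRows.neg_mem_and_energyJ_neg (hw : HasBoundedRows w W) {u : Lattice d → ℝ}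
    (hu : u ∈ nehariSC w h) :
    (fun x => -u x) ∈ nehariSC w h ∧ energyJ w h (fun x => -u x) = energyJ w h u := by
  have hs := hw.signPair_of_mem hu
  have h1 : (-1 : ℝ) ≠ 0 := by norm_num
  have hne : ∀ {f : Lattice d → ℝ}, f ≠ 0 → (fun x => -1 * f x) ≠ 0 := fun {f} hf => by
    obtain ⟨x, hx⟩ := Function.ne_iff.1 hf
    exact Function.ne_iff.2 ⟨x, mul_ne_zero h1 hx⟩
  have hs' : SignPair h (fun x => -1 * uMinus u x) (fun x => -1 * uPlus u x) :=
    ⟨hs.right.smul h1, hs.left.smul h1, fun x => by linarith [hs.nonpos x],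
      fun x => by linarith [hs.nonneg x], fun x => by linarith [hs.disjoint x],
      hne hs.right_ne, hne hs.left_ne⟩
  have heq : (fun x => -u x) = fun x => -1 * uMinus u x + -1 * uPlus u x := by
    ext x
    rw [← uPlus_add_uMinus u x]
    ring
  have hneg : ∀ {f : Lattice d → ℝ}, LogDomain h f →
      nehariForm w h (fun x => -1 * f x) = nehariForm w h f := fun hf => by
    rw [hw.nehariForm_smul hf h1]
    norm_num
  have hE : energyForm w (fun x => -1 * uMinus u x) (fun x => -1 * uPlus u x) =
      energyForm w (uPlus u) (uMinus u) := by
    rw [hw.energyForm_smul hs.right.sq hs.left.sq, energyForm_comm]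
    ring
  have hmem : (fun x => -u x) ∈ nehariSC w h := by
    rw [heq, hs'.mem_nehariSC_iff hw, hneg hs.left, hneg hs.right, hE]
    exact (hw.nehari_eqs hu).symm
  refine ⟨hmem, ?_⟩
  have h2 := hw.sqSum_eq_of_mem hu
  have h3 := hw.sqSum_eq_of_mem hmem
  simp only [sqSum, neg_sq] at h2 h3
  linarith

theorem residual_neg (u : Lattice d → ℝ) (z : Lattice d) :
    residual w h (fun x => -u x) z = -residual w h u z := by
  have : fracLaplacian w (fun x => -u x) z = -fracLaplacian w u z := by
    rw [fracLaplacian, fracLaplacian, ← tsum_neg]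
    exact tsum_congr fun y => by ring
  rw [residual, residual, this, neg_sq]
  ring

/-- The defect is odd in `u` and `-u` is again a minimizer. This settles negative values, and at a
zero of `u` the two one-sided inequalities combine. -/
theorem HasBoundedRows.residual_eq_zero (hw : HasBoundedRows w W) {h₀ : ℝ}
    (hh : ∀ x, h₀ ≤ h x) {u : Lattice d → ℝ} (hu : u ∈ nehariSC w h)
    (hum : energyJ w h u = levelSC w h) (z : Lattice d) : residual w h u z = 0 := by
  obtain ⟨hu', he⟩ := hw.neg_mem_and_energyJ_neg hu
  rw [hum] at he
  rcases lt_trichotomy (u z) 0 with hz | hz | hz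
  · have := hw.residual_eq_zero_of_pos hh hu' he (z := z) (neg_pos.2 hz)
    rwa [residual_neg, neg_eq_zero] at this
  · have h1 := hw.residual_nonneg hh hu hum hz.ge
    have h2 := hw.residual_nonneg hh hu' he (z := z) (by simp [hz])
    rw [residual_neg] at h2
    linarith
  · exact hw.residual_eq_zero_of_pos hh hu hum hz

theorem HasBoundedRows.isPointwiseSolution (hw : HasBoundedRows w W) {u : Lattice d → ℝ}
    (hu : u ∈ domJ w h) (hres : ∀ z, residual w h u z = 0) : IsPointwiseSolution w h u := by
  intro x
  have hL := hw.mem_domJ_iff.1 hu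
  refine ⟨(summable_ne_mul_iff w x fun y => u x - u y).2 (hw.summable_laplacian hL.sq x), ?_⟩
  have := hres x
  rw [residual] at this
  linarith

theorem HasBoundedRows.isWeakSolution (hw : HasBoundedRows w W) {u : Lattice d → ℝ}
    (hu : u ∈ domJ w h) (hres : ∀ z, residual w h u z = 0) : IsWeakSolution w h u := by
  refine ⟨hu, fun φ hφ => ?_⟩
  have hL := hw.mem_domJ_iff.1 hu
  have hφL := hw.mem_domJ_iff.1 hφ
  have hpot : Summable fun x => h x * (u x * φ x) := by
    refine Summable.of_norm_bounded (hL.potential.abs.add hφL.potential.abs) fun x => ?_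
    rw [Real.norm_eq_abs, abs_mul, abs_mul, abs_mul, abs_mul (h x), ← mul_add, abs_sq, abs_sq]
    refine mul_le_mul_of_nonneg_left ?_ (abs_nonneg _)
    nlinarith [sq_abs (u x), sq_abs (φ x), sq_nonneg (|u x| - |φ x|), sq_nonneg (u x),
      sq_nonneg (φ x)]
  -- The pointwise equation also supplies the convergence of the mixed logarithmic series.
  have hterm : ∀ x, u x * φ x * Real.log (u x ^ 2) =
      fracLaplacian w u x * φ x + h x * (u x * φ x) := fun x => by
    have := hres x
    rw [residual] at this
    linear_combination (-φ x) * this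
  rw [derivJ, tsum_congr hterm, (hw.summable_gradForm hL.sq hφL.sq).tsum_add hpot,
    (hw.summable_mul_fracLaplacian hL.sq hφL.sq).tsum_add hpot, hw.tsum_gradForm hL.sq hφL.sq,
    sub_self]

end CriticalPoint

end FracLog

theorem theorem1p2 (d : ℕ) (hd : 1 ≤ d) (s : ℝ) (hs0 : 0 < s) (hs1 : s < 1)
    (w : FracLog.Lattice d → FracLog.Lattice d → ℝ) (hw : FracLog.IsFracKernel s w)
    (h : FracLog.Lattice d → ℝ) (h1 : FracLog.PotentialBelow h)
    (h3 : FracLog.PotentialCoercive h) :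
    ∃ u : FracLog.Lattice d → ℝ,
      FracLog.IsWeakSolution w h u ∧
      FracLog.IsPointwiseSolution w h u ∧
      u ∈ FracLog.nehariSC w h ∧
      BddBelow (FracLog.energyJ w h '' FracLog.nehariSC w h) ∧
      FracLog.energyJ w h u = FracLog.levelSC w h ∧
      0 < FracLog.levelSC w h := by
  obtain ⟨W, hW⟩ := hw.exists_hasBoundedRows hs0
  obtain ⟨h₀, hlow, -, hh⟩ := h1
  obtain ⟨u, hu, hum⟩ := hW.exists_minimizer hd hlow hh h3.finite_sublevel
  have hres := hW.residual_eq_zero hh hu hum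
  refine ⟨u, hW.isWeakSolution hu.1 hres, hW.isPointwiseSolution hu.1 hres, hu,
    hW.bddBelow_energyJ hh, hum, ?_⟩
  rw [← hum]
  exact (mul_pos one_half_pos (Real.exp_pos h₀)).trans_le (hW.exp_le_energyJ hh hu)
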